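/- Let $a,b,c,d$ be indeterminates over $\mathbb{Q}$. For a partition $\lambda=(\lambda_1\ge\lambda_2\ge\cdots)$ put $$\omega(\lambda)=a^{\sum_{i\ge1}\lceil\lambda_{2i-1}/2\rceil}\,b^{\sum_{i\ge1}\lfloor\lambda_{2i-1}/2\rfloor}\,c^{\sum_{i\ge1}\lceil\lambda_{2i}/2\rceil}\,d^{\sum_{i\ge1}\lfloor\lambda_{2i}/2\rfloor}.$$ Let $s_\lambda$ denote the Schur function and $p_r=\sum_{i\ge1}x_i^r$ the $r$-th power sum in countably many variables $x_1,x_2,\dots$, and let $$z=\sum_{\lambda}\omega(\lambda)\,s_\lambda,$$ where the sum runs over all partitions $\lambda$; this is a formal power series in $x_1,x_2,\dots$ over $\mathbb{Q}[a,b,c,d]$ with constant term $1$. Then $$\log z-\sum_{n\ge1}\frac{1}{2n}\,a^n(b^n-c^n)\,p_{2n}-\sum_{n\ge1}\frac{1}{4n}\,a^nb^nc^nd^n\,p_{2n}^2\;\in\;\mathbb{Q}[a,b,c,d][[p_1,p_3,p_5,\dots]],$$ that is, the left-hand side is a formal power series in the odd power sums $p_1,p_3,p_5,\dots$ with coefficients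 in $\mathbb{Q}[a,b,c,d]$. -/

import Mathlib

/-- The alternant `a_α(x_1, …, x_n) = det (x_i ^ α_j)` in `ℤ[x_1, …, x_n]`. -/
noncomputable def alternant (n : ℕ) (α : Fin n → ℕ) : MvPolynomial (Fin n) ℤ :=
  Matrix.det (Matrix.of fun i j => (MvPolynomial.X i : MvPolynomial (Fin n) ℤ) ^ α j)

/-- The staircase `δ = (n - 1, n - 2, …, 1, 0)`. -/
def staircase (n : ℕ) (j : Fin n) : ℕ := n - 1 - (j : ℕ)

/-- The exponent `lam + δ`, where `lam` is regarded as a partition with `n` parts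
`lam.rowLen 0 ≥ lam.rowLen 1 ≥ …`. -/
def shiftedParts (n : ℕ) (lam : YoungDiagram) (j : Fin n) : ℕ := lam.rowLen j + staircase n j

theorem prod_sub_dvd_det_eval {R : Type*} [CommRing R] (n : ℕ) :
    ∀ (v : Fin n → R) (p : Fin n → Polynomial R),
      (Matrix.vandermonde v).det ∣ Matrix.det (Matrix.of fun i j => (p j).eval (v i)) := by
  induction n with
  | zero => intro v p; simp
  | succ n ih =>
    intro v p
    have hq : ∀ j, ∃ q : Polynomial R,
        p j - Polynomial.C ((p j).eval (v 0)) = (Polynomial.X - Polynomial.C (v 0)) * q :=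
      fun j => Polynomial.X_sub_C_dvd_sub_C_eval
    choose q hq using hq
    have hq' : ∀ i j, (p j).eval (v i) = (p j).eval (v 0) + (v i - v 0) * (q j).eval (v i) := by
      intro i j
      have := congrArg (Polynomial.eval (v i)) (hq j)
      simp only [Polynomial.eval_sub, Polynomial.eval_C, Polynomial.eval_mul,
        Polynomial.eval_X] at this
      linear_combination this
    let M : Matrix (Fin (n + 1)) (Fin (n + 1)) R := Matrix.of fun i j =>
      Fin.cases ((p j).eval (v 0))
        (fun k => (v k.succ - v 0) * (q j).eval (v k.succ)) i
    have hM : Matrix.det (Matrix.of fun i j => (p j).eval (v i)) = M.det := by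
      refine Matrix.det_eq_of_forall_row_eq_smul_add_const
        (fun i => Fin.cases (0 : R) (fun _ => 1) i) 0 rfl ?_
      intro i j
      refine Fin.cases ?_ (fun k => ?_) i
      · simp [M]
      · simp only [M, Matrix.of_apply, Fin.cases_succ, Fin.cases_zero]
        rw [hq' k.succ j]
        ring
    rw [hM, Matrix.det_vandermonde, Fin.prod_univ_succ, Matrix.det_succ_row_zero M]
    refine Finset.dvd_sum fun j _ => Dvd.dvd.mul_left ?_ _
    have hs : M.submatrix Fin.succ j.succAbove = Matrix.of fun i k =>
        (fun i : Fin n => v i.succ - v 0) i *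
          (Matrix.of fun (i : Fin n) (k : Fin n) =>
            (q (j.succAbove k)).eval (v i.succ)) i k := by
      ext i k
      simp [M]
    rw [hs, Matrix.det_mul_column]
    refine mul_dvd_mul ?_ ?_
    · simp
    · have := ih (fun i => v i.succ) (fun k => q (j.succAbove k))
      rw [Matrix.det_vandermonde] at this
      simpa [Fin.prod_Ioi_succ] using this

theorem alternant_staircase_dvd (n : ℕ) (α : Fin n → ℕ) :
    alternant n (staircase n) ∣ alternant n α := by
  have h := prod_sub_dvd_det_eval n (fun i => (MvPolynomial.X i : MvPolynomial (Fin n) ℤ))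
    (fun j => Polynomial.X ^ α j)
  simp only [Polynomial.eval_pow, Polynomial.eval_X] at h
  have hrev : alternant n (staircase n) =
      ((Matrix.vandermonde fun i => (MvPolynomial.X i : MvPolynomial (Fin n) ℤ)).submatrix id
        (Fin.revPerm : Equiv.Perm (Fin n))).det := by
    unfold alternant staircase
    congr 1
    ext1 i j
    simp only [Matrix.of_apply, Matrix.submatrix_apply, Matrix.vandermonde_apply, id_eq,
      Fin.revPerm_apply, Fin.val_rev]
    congr 1
    omega
  rw [hrev, Matrix.det_permute']
  refine (IsUnit.mul_left_dvd ?_).2 h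
  exact ((Equiv.Perm.sign (Fin.revPerm : Equiv.Perm (Fin n))).isUnit.map
    (Int.castRingHom (MvPolynomial (Fin n) ℤ)))

theorem exists_schurPoly (n : ℕ) (lam : YoungDiagram) :
    ∃ s : MvPolynomial (Fin n) ℤ,
      alternant n (shiftedParts n lam) = alternant n (staircase n) * s :=
  alternant_staircase_dvd n _

/-- The Schur polynomial `s_lam(x_1, …, x_n) = a_{lam + δ} / a_δ`, for `n ≥ ℓ(lam)`. -/
noncomputable def schurPoly (n : ℕ) (lam : YoungDiagram) : MvPolynomial (Fin n) ℤ :=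
  (exists_schurPoly n lam).choose

theorem alternant_eq_mul_schurPoly (n : ℕ) (lam : YoungDiagram) :
    alternant n (shiftedParts n lam) = alternant n (staircase n) * schurPoly n lam :=
  (exists_schurPoly n lam).choose_spec

/-- A number of variables that is at least `ℓ(lam)` and contains all variables of the
monomial `x ^ m`. -/
def schurVars (lam : YoungDiagram) (m : ℕ →₀ ℕ) : ℕ :=
  max (lam.colLen 0) (m.support.sup fun i => i + 1)

/-- The Schur function `s_lam(x_0, x_1, …)` in countably many variables, as a formal power series:
the coefficient of a monomial is its coefficient in the Schur polynomial `s_lam(x_0, …, x_{n-1})`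
for an `n ≥ ℓ(lam)` such that the monomial involves only `x_0, …, x_{n-1}`
(it does not depend on the choice of such an `n`). -/
noncomputable def schur (R : Type*) [CommRing R] (lam : YoungDiagram) : MvPowerSeries ℕ R :=
  fun m => (((schurPoly (schurVars lam m) lam).coeff
    (m.comapDomain (Fin.val : Fin (schurVars lam m) → ℕ) Fin.val_injective.injOn) : ℤ) : R)

/-- The sum of a family of formal power series, of which only finitely many
contribute to any given monomial. -/
noncomputable def formalSum {ι σ R : Type*} [CommRing R] (f : ι → MvPowerSeries σ R) :
    MvPowerSeries σ R :=
  fun m => ∑ᶠ i, MvPowerSeries.coeff m (f i)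

/-- The power sum `p_r = ∑ x_i ^ r` in countably many variables, `r ≥ 1`. -/
noncomputable def powerSum (R : Type*) [CommRing R] (r : ℕ) : MvPowerSeries ℕ R :=
  formalSum fun i : ℕ => (MvPowerSeries.X i : MvPowerSeries ℕ R) ^ r

open Classical in
theorem coeff_powerSum (R : Type*) [CommRing R] {r : ℕ} (hr : r ≠ 0) (m : ℕ →₀ ℕ) :
    MvPowerSeries.coeff m (powerSum R r) =
      if ∃ i, m = Finsupp.single i r then 1 else 0 := by
  change ∑ᶠ i, MvPowerSeries.coeff m ((MvPowerSeries.X i : MvPowerSeries ℕ R) ^ r) = _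
  simp only [MvPowerSeries.coeff_X_pow]
  split_ifs with h
  · obtain ⟨i, rfl⟩ := h
    rw [finsum_eq_single _ i]
    · simp
    · intro j hj
      rw [if_neg]
      intro h
      exact hj ((Finsupp.single_left_injective hr h).symm)
  · push Not at h
    simp [h]

theorem hasSubst_oddPowerSum (R : Type*) [CommRing R] :
    MvPowerSeries.HasSubst (fun k : ℕ => powerSum R (2 * k + 1)) where
  const_coeff k := by
    rw [← MvPowerSeries.coeff_zero_eq_constantCoeff_apply, coeff_powerSum R (by omega), if_neg]
    · exact IsNilpotent.zero
    · rintro ⟨i, hi⟩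
      have := DFunLike.congr_fun hi i
      simp at this
  coeff_zero m := by
    refine (Set.finite_le_nat m.degree).subset fun k hk => ?_
    replace hk : MvPowerSeries.coeff m (powerSum R (2 * k + 1)) ≠ 0 := hk
    rw [coeff_powerSum R (by omega)] at hk
    split_ifs at hk with h
    · obtain ⟨i, rfl⟩ := h
      change k ≤ (Finsupp.single i (2 * k + 1)).degree
      rw [Finsupp.degree_single]
      omega
    · exact absurd rfl hk

/-- The four-parameter weight `ω(lam)`. The part `λ_i` of the partition is `lam.rowLen (i - 1)`, so
that the odd-indexed parts are `lam.rowLen (2 * i)` with `i ≥ 0`; all parts with an index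
above `ℓ(lam) = lam.colLen 0` vanish. In `ℕ`, `(r + 1) / 2` is the ceiling and `r / 2` the floor
of half of `r`. -/
def omegaWeight {R : Type*} [CommRing R] (a b c d : R) (lam : YoungDiagram) : R :=
  a ^ (∑ i ∈ Finset.range (lam.colLen 0), (lam.rowLen (2 * i) + 1) / 2) *
  b ^ (∑ i ∈ Finset.range (lam.colLen 0), lam.rowLen (2 * i) / 2) *
  c ^ (∑ i ∈ Finset.range (lam.colLen 0), (lam.rowLen (2 * i + 1) + 1) / 2) *
  d ^ (∑ i ∈ Finset.range (lam.colLen 0), lam.rowLen (2 * i + 1) / 2)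

/-- `z = ∑ ω(lam) s_lam`, the sum being over all partitions. -/
noncomputable def schurSum {R : Type*} [CommRing R] (a b c d : R) : MvPowerSeries ℕ R :=
  formalSum fun lam : YoungDiagram => omegaWeight a b c d lam • schur R lam

/-- The logarithm `log f = ∑_{k ≥ 1} (-1)^(k-1) (f - 1)^k / k` of a formal power series `f` with
constant term `1`. -/
noncomputable def logSeries {R : Type*} [CommRing R] [Algebra ℚ R] (f : MvPowerSeries ℕ R) :
    MvPowerSeries ℕ R :=
  PowerSeries.subst (f - 1) (PowerSeries.log R)

/-- The set `R[[p_1, p_3, p_5, …]]` of all formal power series in the odd power sums,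
as formal power series in `x_0, x_1, …`. -/
noncomputable def oddPowerSumSeries (R : Type*) [CommRing R] : Set (MvPowerSeries ℕ R) :=
  Set.range fun G : MvPowerSeries ℕ R =>
    MvPowerSeries.subst (fun k : ℕ => powerSum R (2 * k + 1)) G

/-!
The idea is to study what happens to `z` when a pair of variables `t, -t` is adjoined to the
variables `x`. With `s = a b c d`,

  `(1 - a b t²) (1 - s t⁴) ∏ (1 - s t² x_i²) z(t, -t, x) = (1 - a c t²) z(x)`

(`subst_pairedVars_schurSum`). Hence adjoining `t, -t` changes `log z` by an explicit sum of
logarithms. As `p_{2n}(t, -t, x) = 2 t²ⁿ + p_{2n}(x)`, it changes the two corrections by the same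
amount, so that the corrected logarithm `L` satisfies `L(t, -t, x) = L(x)`
(`subst_pairedVars_correctedLog`). A symmetric series with this cancellation property is a series
in the odd power sums (`IsSymmSeries.mem_oddPowerSumSeries`).

For the identity, write `s_λ` in `2 m` variables as a quotient of alternants. The weight `ω(λ)` is,
up to a power of `s`, a product `α_{l_0} γ_{l_1} α_{l_2} γ_{l_3} ⋯` over the parts `l_j` of `λ + δ`
(`listWeight_shiftedParts`), so that `a_δ z` is a sum of such weights times the determinants
`det (x_i ^ l_j)` over all decreasing sequences `l`. By a minor summation formula
(`pairing_weightElement`), this sum is the Pfaffian with the entries `Q(x_i, x_j) - Q(x_j, x_i)`,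
where `Q(x, y) = ∑_{q < p} α_p γ_q x^p y^q` is a rational function (`pow_dvd_sub_pairSum`). For
`x_0 = t`, `x_1 = -t` the first two rows of this matrix are combinations of two simple vectors, and
eliminating them leaves the Pfaffian of the remaining variables, scaled by `s` and by explicit
factors (`truncatedPfaffian_sub_mem`).

Pfaffians appear here as iterated contractions of an element `exp ω` of an exterior algebra, `ω`
being a `2`-form. It is characterised by the fact that contracting it by a functional amounts to
multiplying it by a vector (`IsPfaffianElement`), which suffices for evaluating the contractions
(`Linked.pairing_sub_mem`). Infinite sums are avoided by truncating `ω` at exponents `p < M`,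
computing modulo the ideal of the `x_i ^ M`, and letting `M` tend to infinity.

For the criterion, comparing coefficients in `f(t, -t, x) = f(x)` expresses the coefficient of a
monomial with an even exponent by coefficients of monomials of the same degree in more variables.
So `f` is determined by its coefficients at monomials with odd exponents
(`IsSymmSeries.eq_zero_of_odd`). These can be prescribed by a series in the odd power sums, because
the products of power sums are triangular with respect to the number of variables
(`coeff_oddPowerProd`, `exists_subst_oddPowerSum_coeff_eq`).
-/

open scoped MvPowerSeries.WithPiTopology

/-! ### Formal sums and logarithms -/

section FormalSums

variable {σ R ι : Type*} [CommRing R]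

theorem hasSum_formalSum [TopologicalSpace R] (f : ι → MvPowerSeries σ R)
    (hf : ∀ m, {i | MvPowerSeries.coeff m (f i) ≠ 0}.Finite) : HasSum f (formalSum f) := by
  rw [MvPowerSeries.WithPiTopology.hasSum_iff_hasSum_coeff]
  intro m
  change HasSum _ (∑ᶠ i, MvPowerSeries.coeff m (f i))
  rw [finsum_eq_sum_of_support_subset (s := (hf m).toFinset) _ (by intro i hi; simpa using hi)]
  exact hasSum_sum_of_ne_finset_zero fun i hi => by simpa using hi

theorem HasSum.subst_mvPowerSeries [TopologicalSpace R] [DiscreteTopology R] {τ : Type*}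
    {f : ι → MvPowerSeries σ R} {g : MvPowerSeries σ R} (h : HasSum f g)
    {u : σ → MvPowerSeries τ R} (hu : MvPowerSeries.HasSubst u) :
    HasSum (fun i => MvPowerSeries.subst u (f i)) (MvPowerSeries.subst u g) := by
  have hT : ‹TopologicalSpace R› = ⊥ := DiscreteTopology.eq_bot
  subst hT
  let _ : UniformSpace R := ⊥
  have hc : Continuous (MvPowerSeries.substAlgHom (R := R) hu) := by
    rw [MvPowerSeries.coe_substAlgHom]
    exact MvPowerSeries.continuous_subst hu
  have := h.map (MvPowerSeries.substAlgHom (R := R) hu) hc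
  simpa only [Function.comp_def, MvPowerSeries.substAlgHom_apply] using this

theorem constantCoeff_subst_of_zero {σ τ : Type*} {u : σ → MvPowerSeries τ R}
    (hu : MvPowerSeries.HasSubst u) (hu0 : ∀ i, MvPowerSeries.constantCoeff (u i) = 0)
    (f : MvPowerSeries σ R) :
    MvPowerSeries.constantCoeff (MvPowerSeries.subst u f) = MvPowerSeries.constantCoeff f := by
  have h := MvPowerSeries.constantCoeff_subst_eq_zero hu hu0
    (f := f - MvPowerSeries.C (MvPowerSeries.constantCoeff f)) (by simp)
  rw [MvPowerSeries.subst_sub hu, map_sub, MvPowerSeries.subst_C] at h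
  simpa [sub_eq_zero] using h

end FormalSums

section Log

variable {R : Type*} [CommRing R] [Algebra ℚ R]

theorem hasSum_logSeries [TopologicalSpace R] [DiscreteTopology R] {f : MvPowerSeries ℕ R}
    (hf : MvPowerSeries.constantCoeff f = 1) :
    HasSum (fun n : ℕ => PowerSeries.coeff n (PowerSeries.log R) • (f - 1) ^ n)
      (logSeries f) := by
  have hs : PowerSeries.HasSubst (f - 1) :=
    PowerSeries.HasSubst.of_constantCoeff_zero (by simp [hf])
  rw [MvPowerSeries.WithPiTopology.hasSum_iff_hasSum_coeff]
  intro m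
  rw [logSeries, PowerSeries.coeff_subst hs]
  have hfin := PowerSeries.coeff_subst_finite hs (PowerSeries.log R) m
  rw [finsum_eq_sum_of_support_subset (s := hfin.toFinset) _ (by intro i hi; simpa using hi)]
  simp only [MvPowerSeries.coeff_smul]
  exact hasSum_sum_of_ne_finset_zero fun i hi => by simpa using hi

/-- The logarithmic derivative. It characterises the logarithm, since a power series over a
`ℚ`-algebra is determined by its partial derivatives and its constant coefficient. -/
theorem mul_pderiv_logSeries {f : MvPowerSeries ℕ R}
    (hf : MvPowerSeries.constantCoeff f = 1) (i : ℕ) :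
    f * MvPowerSeries.pderiv R i (logSeries f) = MvPowerSeries.pderiv R i f := by
  let _ : TopologicalSpace R := ⊥
  have _ : DiscreteTopology R := ⟨rfl⟩
  have hcont : Continuous (MvPowerSeries.pderiv R i : MvPowerSeries ℕ R → MvPowerSeries ℕ R) := by
    refine continuous_pi fun d => ?_
    change Continuous fun g : MvPowerSeries ℕ R =>
      MvPowerSeries.coeff (d + Finsupp.single i 1) g * ((d i : R) + 1)
    exact (MvPowerSeries.WithPiTopology.continuous_coeff R _).mul continuous_const
  have h1 := ((hasSum_logSeries hf).map (MvPowerSeries.pderiv R i) hcont)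
  have h0 : MvPowerSeries.constantCoeff (1 - f) = 0 := by simp [hf]
  have h2 := (MvPowerSeries.WithPiTopology.summable_pow_of_constantCoeff_eq_zero h0).hasSum
  have h3 := MvPowerSeries.WithPiTopology.one_sub_mul_tsum_pow_of_constantCoeff_eq_zero h0
  have h4 := h2.mul_right (MvPowerSeries.pderiv R i f)
  have h5 : HasSum (fun n : ℕ => (1 - f) ^ n * MvPowerSeries.pderiv R i f)
      (MvPowerSeries.pderiv R i (logSeries f)) := by
    rw [← hasSum_nat_add_iff' 1] at h1
    simp only [Finset.range_one, Finset.sum_singleton, Function.comp_apply] at h1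
    have hz : PowerSeries.coeff 0 (PowerSeries.log R) = 0 := by simp
    rw [hz, zero_smul, map_zero, sub_zero] at h1
    -- the derivative of the series of the logarithm is the geometric series in `1 - f`
    refine (congrArg (HasSum · _) (funext fun n => ?_)).mp h1
    · symm
      have hn : algebraMap ℚ R ((-1) ^ (n + 1 + 1) / ((n + 1 : ℕ) : ℚ)) * ((n + 1 : ℕ) : R)
          = (-1) ^ n := by
        have : ((n + 1 : ℕ) : R) = algebraMap ℚ R ((n + 1 : ℕ) : ℚ) := by simp
        rw [this, ← map_mul, div_mul_cancel₀ _ (by positivity)]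
        simp [pow_succ]
      have hp : (1 - f) ^ n = MvPowerSeries.C ((-1 : R) ^ n) * (f - 1) ^ n := by
        rw [← neg_sub f 1, neg_pow]; simp
      rw [Derivation.map_smul, MvPowerSeries.pderiv_pow, map_sub, MvPowerSeries.pderiv_one,
        sub_zero,
        PowerSeries.coeff_log, if_neg (Nat.succ_ne_zero n), hp, ← hn,
        MvPowerSeries.smul_eq_C_mul, map_mul, Nat.add_sub_cancel, map_natCast]
      ring
  rw [h5.unique h4, ← mul_assoc]
  simp only [sub_sub_cancel] at h3
  rw [h3, one_mul]

theorem constantCoeff_logSeries {f : MvPowerSeries ℕ R}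
    (hf : MvPowerSeries.constantCoeff f = 1) :
    MvPowerSeries.constantCoeff (logSeries f) = 0 :=
  PowerSeries.constantCoeff_subst_eq_zero (by simp [hf]) _ PowerSeries.constantCoeff_log

theorem logSeries_mul {f g : MvPowerSeries ℕ R} (hf : MvPowerSeries.constantCoeff f = 1)
    (hg : MvPowerSeries.constantCoeff g = 1) :
    logSeries (f * g) = logSeries f + logSeries g := by
  have hfg : MvPowerSeries.constantCoeff (f * g) = 1 := by simp [hf, hg]
  have _ : IsAddTorsionFree R := IsAddTorsionFree.of_module_rat R
  refine MvPowerSeries.pderiv.ext (fun i => ?_) ?_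
  · have hu : IsUnit (f * g) := by
      rw [MvPowerSeries.isUnit_iff_constantCoeff, hfg]; exact isUnit_one
    refine hu.mul_left_cancel ?_
    rw [mul_pderiv_logSeries hfg, Derivation.leibniz, map_add, smul_eq_mul, smul_eq_mul]
    linear_combination (-g) * mul_pderiv_logSeries hf i - f * mul_pderiv_logSeries hg i
  · simp [constantCoeff_logSeries, hf, hg]

theorem logSeries_one : logSeries (1 : MvPowerSeries ℕ R) = 0 := by
  have := logSeries_mul (R := R) (f := 1) (g := 1) (by simp) (by simp)
  simpa using this

theorem logSeries_prod {ι : Type*} (s : Finset ι) (f : ι → MvPowerSeries ℕ R)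
    (hf : ∀ i ∈ s, MvPowerSeries.constantCoeff (f i) = 1) :
    logSeries (∏ i ∈ s, f i) = ∑ i ∈ s, logSeries (f i) := by
  classical
  induction s using Finset.induction_on with
  | empty => simpa using logSeries_one
  | insert i s hi ih =>
    rw [Finset.prod_insert hi, Finset.sum_insert hi, logSeries_mul (hf i (by simp)),
      ih fun j hj => hf j (by simp [hj])]
    rw [map_prod]
    exact Finset.prod_eq_one fun j hj => hf j (by simp [hj])

theorem hasSum_logSeries_one_sub [TopologicalSpace R] [DiscreteTopology R]
    {y : MvPowerSeries ℕ R} (hy : MvPowerSeries.constantCoeff y = 0) :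
    HasSum (fun n : ℕ+ => (1 / (n : ℚ)) • y ^ (n : ℕ)) (-logSeries (1 - y)) := by
  have h := (hasSum_logSeries (R := R) (f := 1 - y) (by simp [hy])).neg
  rw [← hasSum_nat_add_iff' 1] at h
  simp only [Finset.range_one, Finset.sum_singleton] at h
  have hz : PowerSeries.coeff 0 (PowerSeries.log R) = 0 := by simp
  rw [hz, zero_smul, neg_zero, sub_zero] at h
  rw [← Equiv.pnatEquivNat.symm.hasSum_iff]
  refine (congrArg (HasSum · _) (funext fun n => ?_)).mp h
  · symm
    have h1 : PowerSeries.coeff (n + 1) (PowerSeries.log R) =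
        algebraMap ℚ R ((-1) ^ (n + 1 + 1) / ((n + 1 : ℕ) : ℚ)) := by
      rw [PowerSeries.coeff_log, if_neg (Nat.succ_ne_zero n)]
    rw [h1, algebraMap_smul]
    simp only [Function.comp_apply, Equiv.pnatEquivNat_symm_apply, sub_sub_cancel_left]
    rw [neg_pow y, ← neg_smul]
    have h2 : ((-1 : MvPowerSeries ℕ R)) ^ (n + 1) = (((-1 : ℚ) ^ (n + 1) : ℚ) : ℚ) • 1 := by
      rcases Nat.even_or_odd (n + 1) with h | h <;> simp [h.neg_one_pow]
    rw [h2, smul_mul_assoc, one_mul, smul_smul]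
    congr 1
    have h3 : (-1 : ℚ) ^ (n + 1) * (-1) ^ (n + 1) = 1 := by rw [← mul_pow]; simp
    rw [Nat.succPNat_coe, Nat.succ_eq_add_one, pow_succ _ (n + 1)]
    linear_combination (-(1 / ((n + 1 : ℕ) : ℚ))) * h3

theorem subst_logSeries {u : ℕ → MvPowerSeries ℕ R} (hu : MvPowerSeries.HasSubst u)
    {f : MvPowerSeries ℕ R} (hf : MvPowerSeries.constantCoeff f = 1) :
    MvPowerSeries.subst u (logSeries f) = logSeries (MvPowerSeries.subst u f) := by
  have hs : PowerSeries.HasSubst (f - 1) :=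
    PowerSeries.HasSubst.of_constantCoeff_zero (by simp [hf])
  unfold logSeries PowerSeries.subst
  rw [MvPowerSeries.subst_comp_subst_apply hs.const hu, MvPowerSeries.subst_sub hu,
    ← MvPowerSeries.substAlgHom_apply hu 1, map_one]

end Log

/-! ### Schur polynomials and Schur functions -/

section Alternants

theorem aeval_alternant {S : Type*} [CommRing S] [Algebra ℤ S] {n : ℕ}
    (u : Fin n → S) (α : Fin n → ℕ) :
    MvPolynomial.aeval u (alternant n α) = Matrix.det (Matrix.of fun i j => u i ^ α j) := by
  rw [alternant, AlgHom.map_det]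
  congr 1
  ext i j
  simp

theorem det_staircase {S : Type*} [CommRing S] {n : ℕ} (u : Fin n → S) :
    Matrix.det (Matrix.of fun i j => u i ^ staircase n j) =
      ∏ i : Fin n, ∏ j ∈ Finset.Ioi i, (u i - u j) := by
  have h := Matrix.det_projVandermonde (fun _ => (1 : S)) u
  simp only [one_mul] at h
  rw [← h]
  congr 1
  ext i j
  simp only [Matrix.of_apply, Matrix.projVandermonde_apply, one_pow, one_mul, staircase,
    Fin.val_rev]
  congr 1
  omega

theorem alternant_staircase_ne_zero (n : ℕ) : alternant n (staircase n) ≠ 0 := by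
  rw [alternant, det_staircase, Finset.prod_ne_zero_iff]
  intro i _
  rw [Finset.prod_ne_zero_iff]
  intro j hj
  rw [sub_ne_zero]
  exact fun h => (Finset.mem_Ioi.mp hj).ne (MvPolynomial.X_injective h)

theorem rename_alternant {n : ℕ} (e : Equiv.Perm (Fin n)) (α : Fin n → ℕ) :
    MvPolynomial.rename e (alternant n α) =
      ((Equiv.Perm.sign e : ℤ) : MvPolynomial (Fin n) ℤ) * alternant n α := by
  rw [alternant, AlgHom.map_det, ← Matrix.det_permute]
  congr 1
  ext1 i j
  simp

theorem isHomogeneous_alternant {n : ℕ} (α : Fin n → ℕ) :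
    (alternant n α).IsHomogeneous (∑ j, α j) := by
  rw [alternant, Matrix.det_apply]
  refine MvPolynomial.IsHomogeneous.sum _ _ _ fun e _ => ?_
  have : (∏ i, (Matrix.of fun i j => (MvPolynomial.X i : MvPolynomial (Fin n) ℤ) ^ α j) (e i) i
      ).IsHomogeneous (∑ j, α j) :=
    MvPolynomial.IsHomogeneous.prod _ _ _ fun i _ => MvPolynomial.isHomogeneous_X_pow _ _
  rcases Int.units_eq_one_or (Equiv.Perm.sign e) with h | h
  · simpa [h] using this
  · simpa [h] using this.neg

/-- Setting the last variable to zero kills an alternant without the exponent `0`. -/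
theorem killCompl_alternant_of_pos {n : ℕ} (α : Fin (n + 1) → ℕ) (hα : ∀ j, α j ≠ 0) :
    MvPolynomial.killCompl (Fin.castSucc_injective n) (alternant (n + 1) α) = 0 := by
  rw [alternant, AlgHom.map_det]
  refine Matrix.det_eq_zero_of_row_eq_zero (Fin.last n) fun j => ?_
  simp [MvPolynomial.killCompl, hα j]

/-- Setting the last variable to zero in an alternant whose last exponent is `0`: the last row
becomes a unit vector, and every remaining row is divisible by its variable. -/
theorem killCompl_alternant_of_zero {n : ℕ} (α : Fin (n + 1) → ℕ) (β : Fin n → ℕ)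
    (h0 : α (Fin.last n) = 0) (hα : ∀ j : Fin n, α j.castSucc = β j + 1) :
    MvPolynomial.killCompl (Fin.castSucc_injective n) (alternant (n + 1) α) =
      (∏ i, MvPolynomial.X i) * alternant n β := by
  have hl : MvPolynomial.killCompl (R := ℤ) (Fin.castSucc_injective n)
      (MvPolynomial.X (Fin.last n)) = 0 := by
    simp [MvPolynomial.killCompl]
  have hc (i : Fin n) : MvPolynomial.killCompl (R := ℤ) (Fin.castSucc_injective n)
      (MvPolynomial.X i.castSucc) = MvPolynomial.X i := by
    rw [← MvPolynomial.rename_X, MvPolynomial.killCompl_rename_app]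
  rw [alternant, AlgHom.map_det, Matrix.det_succ_row _ (Fin.last n), Fin.sum_univ_castSucc,
    Finset.sum_eq_zero, zero_add, alternant, ← Matrix.det_mul_column]
  · have : (-1 : MvPolynomial (Fin n) ℤ) ^ (((Fin.last n : Fin (n + 1)) : ℕ) +
        ((Fin.last n : Fin (n + 1)) : ℕ)) = 1 := Even.neg_one_pow ⟨_, rfl⟩
    rw [this]
    simp only [one_mul, AlgHom.mapMatrix_apply, Matrix.map_apply, Matrix.of_apply, h0, pow_zero,
      map_one]
    congr 1
    ext1 i j
    simp [hc, hα, pow_succ']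
  · intro j _
    simp [hl, hα]

theorem shiftedParts_bot (n : ℕ) : shiftedParts n ⊥ = staircase n := by
  ext j
  have : (⊥ : YoungDiagram).rowLen j = 0 := by
    by_contra h
    exact YoungDiagram.notMem_bot ((j : ℕ), 0)
      (YoungDiagram.mem_iff_lt_rowLen.mpr (Nat.pos_of_ne_zero h))
  simp [shiftedParts, this]

theorem shiftedParts_castSucc (n : ℕ) (lam : YoungDiagram) (j : Fin n) :
    shiftedParts (n + 1) lam j.castSucc = shiftedParts n lam j + 1 := by
  have := j.isLt
  simp only [shiftedParts, staircase, Fin.val_castSucc]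
  omega

theorem shiftedParts_last (n : ℕ) (lam : YoungDiagram) :
    shiftedParts (n + 1) lam (Fin.last n) = lam.rowLen n := by
  simp [shiftedParts, staircase]

theorem rowLen_eq_zero_iff (lam : YoungDiagram) (n : ℕ) :
    lam.rowLen n = 0 ↔ lam.colLen 0 ≤ n := by
  have h1 := YoungDiagram.mem_iff_lt_rowLen (μ := lam) (i := n) (j := 0)
  have h2 := YoungDiagram.mem_iff_lt_colLen (μ := lam) (i := n) (j := 0)
  rw [h1] at h2
  omega

end Alternants

section SchurPoly

/-- Stability of Schur polynomials: setting the last variable to zero gives the Schur polynomial in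
one variable less, or zero when the partition has too many parts. -/
theorem killCompl_schurPoly (n : ℕ) (lam : YoungDiagram) :
    MvPolynomial.killCompl (Fin.castSucc_injective n) (schurPoly (n + 1) lam) =
      if lam.colLen 0 ≤ n then schurPoly n lam else 0 := by
  have h := congrArg (MvPolynomial.killCompl (Fin.castSucc_injective n))
    (alternant_eq_mul_schurPoly (n + 1) lam)
  have hX : (∏ i, MvPolynomial.X i : MvPolynomial (Fin n) ℤ) ≠ 0 :=
    Finset.prod_ne_zero_iff.mpr fun i _ => MvPolynomial.X_ne_zero i
  have hδ : MvPolynomial.killCompl (Fin.castSucc_injective n)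
      (alternant (n + 1) (staircase (n + 1))) =
        (∏ i, MvPolynomial.X i) * alternant n (staircase n) := by
    rw [← shiftedParts_bot, ← shiftedParts_bot]
    refine killCompl_alternant_of_zero _ _ ?_ fun j => shiftedParts_castSucc n _ j
    rw [shiftedParts_bot]
    simp [staircase]
  rw [map_mul, hδ] at h
  refine mul_left_cancel₀ (mul_ne_zero hX (alternant_staircase_ne_zero n)) ?_
  rw [← h]
  split_ifs with hl
  · rw [mul_assoc, ← alternant_eq_mul_schurPoly]
    refine killCompl_alternant_of_zero _ _ ?_ fun j => shiftedParts_castSucc n _ j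
    rw [shiftedParts_last, (rowLen_eq_zero_iff lam n).mpr hl]
  · rw [mul_zero]
    refine killCompl_alternant_of_pos _ fun j => ?_
    refine Fin.lastCases ?_ (fun j => ?_) j
    · rw [shiftedParts_last, Ne, rowLen_eq_zero_iff]
      exact hl
    · rw [shiftedParts_castSucc]
      omega

theorem rename_schurPoly {n : ℕ} (e : Equiv.Perm (Fin n)) (lam : YoungDiagram) :
    MvPolynomial.rename e (schurPoly n lam) = schurPoly n lam := by
  have h := congrArg (MvPolynomial.rename e) (alternant_eq_mul_schurPoly n lam)
  rw [map_mul, rename_alternant, rename_alternant, alternant_eq_mul_schurPoly, ← mul_assoc] at h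
  refine (mul_left_cancel₀ (mul_ne_zero ?_ (alternant_staircase_ne_zero n)) h).symm
  exact_mod_cast (Equiv.Perm.sign e).ne_zero

theorem isHomogeneous_of_mul {σ : Type*} {p q : MvPolynomial σ ℤ} {c d : ℕ} (hp : p ≠ 0)
    (hpc : p.IsHomogeneous c) (hpq : (p * q).IsHomogeneous (c + d)) : q.IsHomogeneous d := by
  have key : ∀ k, k ≠ d → MvPolynomial.homogeneousComponent k q = 0 := by
    intro k hk
    have h1 : MvPolynomial.homogeneousComponent (c + k) (p * q) = 0 := by
      rw [MvPolynomial.homogeneousComponent_of_mem hpq, if_neg (by omega)]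
    have h2 : MvPolynomial.homogeneousComponent (c + k) (p * q) =
        p * MvPolynomial.homogeneousComponent k q := by
      conv_lhs => rw [← MvPolynomial.sum_homogeneousComponent q, Finset.mul_sum, map_sum]
      have h3 : ∀ i, MvPolynomial.homogeneousComponent (c + k)
          (p * MvPolynomial.homogeneousComponent i q) =
            if k = i then p * MvPolynomial.homogeneousComponent i q else 0 := by
        intro i
        rw [MvPolynomial.homogeneousComponent_of_mem
          (hpc.mul (MvPolynomial.homogeneousComponent_isHomogeneous i q))]
        simp
      simp only [h3, Finset.sum_ite_eq, Finset.mem_range]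
      split_ifs with h
      · rfl
      · rw [MvPolynomial.homogeneousComponent_eq_zero _ _ (by omega), mul_zero]
    rw [h1] at h2
    exact (mul_eq_zero.mp h2.symm).resolve_left hp
  rw [← MvPolynomial.sum_homogeneousComponent q]
  refine MvPolynomial.IsHomogeneous.sum _ _ _ fun k _ => ?_
  by_cases hk : k = d
  · rw [hk]
    exact MvPolynomial.homogeneousComponent_isHomogeneous d q
  · rw [key k hk]
    exact MvPolynomial.isHomogeneous_zero _ _ _

theorem isHomogeneous_schurPoly (n : ℕ) (lam : YoungDiagram) :
    (schurPoly n lam).IsHomogeneous (∑ j : Fin n, lam.rowLen j) := by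
  refine isHomogeneous_of_mul (alternant_staircase_ne_zero n) (isHomogeneous_alternant _) ?_
  rw [← alternant_eq_mul_schurPoly, ← Finset.sum_add_distrib]
  simp only [add_comm (staircase n _)]
  exact isHomogeneous_alternant _

end SchurPoly

section Schur

variable (R : Type*) [CommRing R]

/-- The exponent in `Fin n` variables of a monomial in countably many variables. -/
noncomputable def restrictExponent (n : ℕ) (m : ℕ →₀ ℕ) : Fin n →₀ ℕ :=
  m.comapDomain (Fin.val : Fin n → ℕ) Fin.val_injective.injOn

@[simp]
theorem restrictExponent_apply (n : ℕ) (m : ℕ →₀ ℕ) (i : Fin n) :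
    restrictExponent n m i = m i := rfl

theorem coeff_schurPoly_succ (n : ℕ) (lam : YoungDiagram) (m : ℕ →₀ ℕ) (hm : ∀ i, n ≤ i → m i = 0) :
    (schurPoly (n + 1) lam).coeff (restrictExponent (n + 1) m) =
      if lam.colLen 0 ≤ n then (schurPoly n lam).coeff (restrictExponent n m) else 0 := by
  have h := congrArg (MvPolynomial.coeff (restrictExponent n m)) (killCompl_schurPoly n lam)
  rw [MvPolynomial.coeff_killCompl] at h
  have hr : (restrictExponent n m).mapDomain Fin.castSucc = restrictExponent (n + 1) m := by
    ext i
    refine Fin.lastCases ?_ (fun i => ?_) i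
    · rw [Finsupp.mapDomain_of_notMem_range _ _
        (by rintro ⟨i, hi⟩; exact Fin.castSucc_ne_last i hi)]
      exact (hm n le_rfl).symm
    · rw [Finsupp.mapDomain_apply (Fin.castSucc_injective n)]
      rfl
  rw [hr] at h
  rw [h]
  split_ifs <;> simp

theorem coeff_schurPoly_of_le {n k : ℕ} (hnk : n ≤ k) (lam : YoungDiagram) (m : ℕ →₀ ℕ)
    (hm : ∀ i, n ≤ i → m i = 0) (hl : lam.colLen 0 ≤ n) :
    (schurPoly k lam).coeff (restrictExponent k m) =
      (schurPoly n lam).coeff (restrictExponent n m) := by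
  induction k, hnk using Nat.le_induction with
  | base => rfl
  | succ k hk ih =>
    rw [coeff_schurPoly_succ k lam m fun i hi => hm i (hk.trans hi), if_pos (hl.trans hk), ih]

/-- The coefficients of a Schur function can be read off from the Schur polynomial in any
sufficiently large number of variables. -/
theorem coeff_schur {n : ℕ} {lam : YoungDiagram} {m : ℕ →₀ ℕ} (hl : lam.colLen 0 ≤ n)
    (hm : ∀ i, n ≤ i → m i = 0) :
    MvPowerSeries.coeff m (schur R lam) =
      (((schurPoly n lam).coeff (restrictExponent n m) : ℤ) : R) := by
  change (((schurPoly (schurVars lam m) lam).coeff (restrictExponent _ m) : ℤ) : R) = _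
  have h : schurVars lam m ≤ n := by
    refine max_le hl (Finset.sup_le fun i hi => ?_)
    by_contra h
    exact (Finsupp.mem_support_iff.mp hi) (hm i (by omega))
  rw [coeff_schurPoly_of_le h lam m _ (le_max_left _ _)]
  intro i hi
  by_contra hne
  have : i + 1 ≤ schurVars lam m :=
    (Finset.le_sup (f := fun i => i + 1) (Finsupp.mem_support_iff.mpr hne)).trans
      (le_max_right _ _)
  omega

theorem coeff_schur_eq_zero {n : ℕ} {lam : YoungDiagram} {m : ℕ →₀ ℕ} (hl : n < lam.colLen 0)
    (hm : ∀ i, n ≤ i → m i = 0) : MvPowerSeries.coeff m (schur R lam) = 0 := by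
  obtain ⟨k, hk⟩ : ∃ k, lam.colLen 0 = k + 1 := ⟨lam.colLen 0 - 1, by omega⟩
  have hm' : ∀ i, k ≤ i → m i = 0 := fun i hi => hm i (by omega)
  rw [coeff_schur R hk.le fun i hi => hm' i (by omega), coeff_schurPoly_succ k lam m hm',
    if_neg (by omega), Int.cast_zero]

theorem exists_forall_le_eq_zero (m : ℕ →₀ ℕ) : ∃ n, ∀ i, n ≤ i → m i = 0 := by
  refine ⟨m.support.sup id + 1, fun i hi => ?_⟩
  by_contra h
  have : i ≤ m.support.sup id := Finset.le_sup (f := id) (Finsupp.mem_support_iff.mpr h)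
  omega

theorem sum_rowLen {n : ℕ} {lam : YoungDiagram} (hl : lam.colLen 0 ≤ n) :
    ∑ j : Fin n, lam.rowLen j = lam.card := by
  rw [Fin.sum_univ_eq_sum_range (fun j => lam.rowLen j) n, YoungDiagram.card]
  rw [Finset.card_eq_sum_card_fiberwise (f := Prod.fst) (t := Finset.range n)]
  · refine Finset.sum_congr rfl fun i _ => ?_
    rw [YoungDiagram.rowLen_eq_card]
    rfl
  · intro c hc
    have h1 : (c.1, 0) ∈ lam := lam.up_left_mem le_rfl (Nat.zero_le c.2) (by simpa using hc)
    have h2 := YoungDiagram.mem_iff_lt_colLen.mp h1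
    simpa using h2.trans_le hl

theorem degree_eq_of_coeff_schur_ne_zero {lam : YoungDiagram} {m : ℕ →₀ ℕ}
    (h : MvPowerSeries.coeff m (schur R lam) ≠ 0) : m.degree = lam.card := by
  obtain ⟨k, hk⟩ := exists_forall_le_eq_zero m
  set n := max k (lam.colLen 0)
  have hm : ∀ i, n ≤ i → m i = 0 := fun i hi => hk i ((le_max_left _ _).trans hi)
  rw [coeff_schur R (le_max_right k _) hm] at h
  have h1 : (schurPoly n lam).coeff (restrictExponent n m) ≠ 0 := fun h0 => h (by
    rw [h0, Int.cast_zero])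
  have h2 := isHomogeneous_schurPoly n lam h1
  rw [sum_rowLen (le_max_right k _)] at h2
  rw [← h2, Finsupp.weight_apply, Finsupp.sum_fintype _ _ (by simp)]
  simp only [restrictExponent_apply, Pi.one_apply, smul_eq_mul, mul_one]
  rw [Fin.sum_univ_eq_sum_range (fun j => m j) n, Finsupp.degree]
  refine Finset.sum_subset (fun i hi => ?_) fun i _ hi => by simpa using hi
  by_contra hn
  exact Finsupp.mem_support_iff.mp hi (hm i (by simpa using hn))

theorem finite_setOf_card_eq (n : ℕ) : {lam : YoungDiagram | lam.card = n}.Finite := by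
  refine Set.Finite.of_finite_image (f := YoungDiagram.cells)
    ((Finset.range n ×ˢ Finset.range n).powerset.finite_toSet.subset ?_)
    fun _ _ _ _ h => YoungDiagram.ext h
  rintro _ ⟨lam, rfl, rfl⟩
  simp only [Finset.coe_powerset, Set.mem_preimage, Set.mem_powerset_iff]
  rintro ⟨i, j⟩ hij
  have hij' : (i, j) ∈ lam := by simpa using hij
  have h1 : lam.colLen j ≤ lam.card := by
    rw [YoungDiagram.colLen_eq_card]
    exact Finset.card_le_card (Finset.filter_subset _ _)
  have h2 : lam.rowLen i ≤ lam.card := by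
    rw [YoungDiagram.rowLen_eq_card]
    exact Finset.card_le_card (Finset.filter_subset _ _)
  have h3 := YoungDiagram.mem_iff_lt_colLen.mp hij'
  have h4 := YoungDiagram.mem_iff_lt_rowLen.mp hij'
  simp only [Finset.coe_product, Finset.coe_range, Set.mem_prod, Set.mem_Iio]
  omega

variable {R}

theorem hasSum_schurSum [TopologicalSpace R] (a b c d : R) :
    HasSum (fun lam => omegaWeight a b c d lam • schur R lam) (schurSum a b c d) := by
  refine hasSum_formalSum _ fun m => (finite_setOf_card_eq m.degree).subset fun lam hlam => ?_
  refine (degree_eq_of_coeff_schur_ne_zero R (m := m) fun h => hlam ?_).symm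
  rw [MvPowerSeries.coeff_smul, h, mul_zero]

theorem hasSubst_of_eventually_zero {σ : Type*} {u : ℕ → MvPowerSeries σ R} {N : ℕ}
    (h0 : ∀ i, MvPowerSeries.constantCoeff (u i) = 0) (hN : ∀ i, N ≤ i → u i = 0) :
    MvPowerSeries.HasSubst u where
  const_coeff i := by rw [h0]; exact IsNilpotent.zero
  coeff_zero m := (Set.finite_lt_nat N).subset fun i hi => by
    by_contra h
    exact hi (by rw [hN i (not_lt.mp h), map_zero])

theorem subst_congr_of_eventually_zero {σ : Type*} {u : ℕ → MvPowerSeries σ R} {N : ℕ}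
    (hu : MvPowerSeries.HasSubst u) (hN : ∀ i, N ≤ i → u i = 0) {f g : MvPowerSeries ℕ R}
    (hfg : ∀ m : ℕ →₀ ℕ, (∀ i, N ≤ i → m i = 0) →
      MvPowerSeries.coeff m f = MvPowerSeries.coeff m g) :
    MvPowerSeries.subst u f = MvPowerSeries.subst u g := by
  ext m
  rw [MvPowerSeries.coeff_subst hu, MvPowerSeries.coeff_subst hu]
  refine finsum_congr fun k => ?_
  by_cases hk : ∀ i, N ≤ i → k i = 0
  · rw [hfg k hk]
  · push Not at hk
    obtain ⟨i, hi, hki⟩ := hk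
    have : (k.prod fun s e => u s ^ e) = 0 :=
      Finset.prod_eq_zero (Finsupp.mem_support_iff.mpr hki) (by
        change u i ^ k i = 0
        rw [hN i hi, zero_pow hki])
    rw [this, map_zero, smul_zero, smul_zero]

/-- Schur functions with all but `N` variables set to zero are Schur polynomials. -/
theorem subst_schur {σ : Type*} {u : ℕ → MvPowerSeries σ R} {N : ℕ}
    (hu : MvPowerSeries.HasSubst u) (hN : ∀ i, N ≤ i → u i = 0) (lam : YoungDiagram) :
    MvPowerSeries.subst u (schur R lam) =
      if lam.colLen 0 ≤ N then
        MvPolynomial.aeval (fun i : Fin N => u i) (schurPoly N lam) else 0 := by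
  split_ifs with hl
  · have h1 := subst_congr_of_eventually_zero hu hN (f := schur R lam)
      (g := ((MvPolynomial.rename (Fin.val : Fin N → ℕ) (MvPolynomial.map (Int.castRingHom R)
        (schurPoly N lam)) : MvPolynomial ℕ R) : MvPowerSeries ℕ R)) fun m hm => by
      rw [coeff_schur R hl hm, MvPolynomial.coeff_coe]
      have : m = (restrictExponent N m).mapDomain Fin.val := by
        refine (Finsupp.mapDomain_comapDomain _ Fin.val_injective m fun i hi => ?_).symm
        have : i < N := by
          by_contra h
          exact Finsupp.mem_support_iff.mp hi (hm i (by omega))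
        exact ⟨⟨i, this⟩, rfl⟩
      conv_rhs => rw [this]
      rw [MvPolynomial.coeff_rename_mapDomain _ Fin.val_injective, MvPolynomial.coeff_map]
      rfl
    rw [h1, MvPowerSeries.subst_coe, MvPolynomial.aeval_rename]
    rw [MvPolynomial.aeval_def, MvPolynomial.aeval_def, MvPolynomial.eval₂_map]
    congr 1
    exact RingHom.ext_int _ _
  · have h1 := subst_congr_of_eventually_zero hu hN (f := schur R lam) (g := 0) fun m hm => by
      rw [coeff_schur_eq_zero R (not_le.mp hl) hm, map_zero]
    rw [h1, ← MvPowerSeries.substAlgHom_apply hu, map_zero]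

end Schur

section Symmetry

variable {R : Type*} [CommRing R]

theorem hasSubst_X_comp (e : Equiv.Perm ℕ) :
    MvPowerSeries.HasSubst (fun i => (MvPowerSeries.X (e i) : MvPowerSeries ℕ R)) where
  const_coeff i := by simp
  coeff_zero m := by
    have h := (MvPowerSeries.HasSubst.X (σ := ℕ) (S := R)).coeff_zero m
    exact (h.preimage e.injective.injOn)

theorem coeff_subst_X_comp (e : Equiv.Perm ℕ) (f : MvPowerSeries ℕ R) (m : ℕ →₀ ℕ) :
    MvPowerSeries.coeff (m.mapDomain e)
      (MvPowerSeries.subst (fun i => (MvPowerSeries.X (e i) : MvPowerSeries ℕ R)) f) =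
      MvPowerSeries.coeff m f := by
  classical
  have hp (k : ℕ →₀ ℕ) : (k.prod fun s n => (MvPowerSeries.X (e s) : MvPowerSeries ℕ R) ^ n) =
      MvPowerSeries.monomial (k.mapDomain e) 1 := by
    have h1 : (k.prod fun s n => (MvPowerSeries.X (e s) : MvPowerSeries ℕ R) ^ n) =
        (k.mapDomain e).prod fun s n => (MvPowerSeries.X s : MvPowerSeries ℕ R) ^ n :=
      (Finsupp.prod_mapDomain_index_inj
        (h := fun s n => (MvPowerSeries.X s : MvPowerSeries ℕ R) ^ n) e.injective).symm
    rw [h1, MvPowerSeries.monomial_one_eq]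
  rw [MvPowerSeries.coeff_subst (hasSubst_X_comp e), finsum_eq_single _ m]
  · rw [hp, MvPowerSeries.coeff_monomial, if_pos rfl, smul_eq_mul, mul_one]
  · intro k hk
    rw [hp, MvPowerSeries.coeff_monomial, if_neg, smul_zero]
    exact fun h => hk (Finsupp.mapDomain_injective e.injective h).symm

/-- A power series is symmetric if it is invariant under all transpositions of variables. -/
def IsSymmSeries (f : MvPowerSeries ℕ R) : Prop :=
  ∀ i j : ℕ, MvPowerSeries.subst
    (fun k => (MvPowerSeries.X (Equiv.swap i j k) : MvPowerSeries ℕ R)) f = f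

theorem isSymmSeries_of_coeff {f : MvPowerSeries ℕ R}
    (h : ∀ (i j : ℕ) (m : ℕ →₀ ℕ), MvPowerSeries.coeff (m.mapDomain (Equiv.swap i j)) f =
      MvPowerSeries.coeff m f) : IsSymmSeries f := by
  intro i j
  ext m
  have hm : m = (m.mapDomain (Equiv.swap i j)).mapDomain (Equiv.swap i j) := by
    rw [← Finsupp.mapDomain_comp, ← Equiv.coe_trans]
    simp
  rw [hm, coeff_subst_X_comp, h, h]
  exact h i j m ▸ rfl

theorem IsSymmSeries.coeff_mapDomain {f : MvPowerSeries ℕ R} (h : IsSymmSeries f) (i j : ℕ)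
    (m : ℕ →₀ ℕ) : MvPowerSeries.coeff (m.mapDomain (Equiv.swap i j)) f =
      MvPowerSeries.coeff m f := by
  conv_lhs => rw [← h i j]
  exact coeff_subst_X_comp _ f m

theorem isSymmSeries_schur (lam : YoungDiagram) : IsSymmSeries (schur R lam) := by
  refine isSymmSeries_of_coeff fun i j m => ?_
  obtain ⟨k, hk⟩ := exists_forall_le_eq_zero m
  set n := k + lam.colLen 0 + i + j + 1 with hn
  have hi : i < n := by omega
  have hj : j < n := by omega
  have hm : ∀ l, n ≤ l → m l = 0 := fun l hl => hk l (by omega)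
  have hm' : ∀ l, n ≤ l → m.mapDomain (Equiv.swap i j) l = 0 := fun l hl => by
    rw [Finsupp.mapDomain_equiv_apply, Equiv.symm_swap,
      Equiv.swap_apply_of_ne_of_ne (by omega) (by omega), hm l hl]
  rw [coeff_schur R (by omega) hm', coeff_schur R (by omega) hm]
  have h : restrictExponent n (m.mapDomain (Equiv.swap i j)) =
      (restrictExponent n m).mapDomain (Equiv.swap (⟨i, hi⟩ : Fin n) ⟨j, hj⟩) := by
    ext l
    rw [restrictExponent_apply, Finsupp.mapDomain_equiv_apply, Finsupp.mapDomain_equiv_apply,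
      restrictExponent_apply, Equiv.symm_swap, Equiv.symm_swap]
    congr 1
    simp only [Equiv.swap_apply_def, Fin.ext_iff]
    split_ifs <;> rfl
  rw [h]
  conv_lhs => rw [← rename_schurPoly (Equiv.swap (⟨i, hi⟩ : Fin n) ⟨j, hj⟩) lam]
  rw [MvPolynomial.coeff_rename_mapDomain _ (Equiv.injective _)]

end Symmetry

/-! ### Contractions in the exterior algebra and Pfaffian elements -/

section ExteriorAlgebra

open ExteriorAlgebra CliffordAlgebra

variable {S V V' : Type*} [CommRing S] [AddCommGroup V] [Module S V] [AddCommGroup V'] [Module S V']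

/-- The scalar part of the iterated contraction of `x` by the functionals in a list, the head of
the list being contracted first. -/
noncomputable def pairing (ds : List (Module.Dual S V)) (x : ExteriorAlgebra S V) : S :=
  algebraMapInv (ds.foldl (fun y d => contractLeft d y) x)

@[simp]
theorem pairing_nil (x : ExteriorAlgebra S V) : pairing [] x = algebraMapInv x := rfl

@[simp]
theorem pairing_cons (d : Module.Dual S V) (ds : List (Module.Dual S V)) (x : ExteriorAlgebra S V) :
    pairing (d :: ds) x = pairing ds (contractLeft d x) := rfl

theorem pairing_add (ds : List (Module.Dual S V)) (x y : ExteriorAlgebra S V) :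
    pairing ds (x + y) = pairing ds x + pairing ds y := by
  induction ds generalizing x y with
  | nil => simp
  | cons d ds ih => simp [ih]

theorem pairing_smul (ds : List (Module.Dual S V)) (r : S) (x : ExteriorAlgebra S V) :
    pairing ds (r • x) = r * pairing ds x := by
  induction ds generalizing x with
  | nil => simp
  | cons d ds ih => simp [ih]

theorem pairing_zero (ds : List (Module.Dual S V)) :
    pairing ds (0 : ExteriorAlgebra S V) = 0 := by
  simpa using pairing_smul ds 0 (0 : ExteriorAlgebra S V)

theorem pairing_sum {I : Type*} (ds : List (Module.Dual S V)) (s : Finset I)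
    (f : I → ExteriorAlgebra S V) : pairing ds (∑ i ∈ s, f i) = ∑ i ∈ s, pairing ds (f i) := by
  classical
  induction s using Finset.induction_on with
  | empty => simp [pairing_zero]
  | insert i s hi ih => rw [Finset.sum_insert hi, Finset.sum_insert hi, pairing_add, ih]

theorem pairing_listSum (ds : List (Module.Dual S V)) (l : List (ExteriorAlgebra S V)) :
    pairing ds l.sum = (l.map (pairing ds)).sum := by
  induction l with
  | nil => simp [pairing_zero]
  | cons x l ih => simp [pairing_add, ih]

theorem contractLeft_ιMulti {n : ℕ} (d : Module.Dual S V) (v : Fin (n + 1) → V) :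
    contractLeft d (ιMulti S (n + 1) v) =
      ∑ j : Fin (n + 1), ((-1) ^ (j : ℕ) * d (v j)) • ιMulti S n (v ∘ j.succAbove) := by
  induction n with
  | zero => simp [ιMulti_apply, Algebra.smul_def]
  | succ n ih =>
    have h0 (k : ℕ) (w : Fin (k + 1) → V) :
        ιMulti S (k + 1) w = ι S (w 0) * ιMulti S k (w ∘ Fin.succ) := by
      rw [ιMulti_apply, List.ofFn_succ, List.prod_cons, ιMulti_apply]
      rfl
    rw [h0, contractLeft_ι_mul, ih, Fin.sum_univ_succ (n := n + 1), Finset.mul_sum, sub_eq_add_neg,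
      ← Finset.sum_neg_distrib]
    congr 1
    · simp [Function.comp_def]
    · refine Finset.sum_congr rfl fun j _ => ?_
      rw [h0 n (v ∘ j.succ.succAbove), mul_smul_comm, ← neg_smul]
      congr 1
      · simp [pow_succ]
      · simp [Function.comp_def]

/-- The pairing of functionals with a product of as many vectors is a determinant. -/
theorem pairing_ιMulti {n : ℕ} (d : Fin n → Module.Dual S V) (v : Fin n → V) :
    pairing (List.ofFn d) (ιMulti S n v) = Matrix.det (Matrix.of fun i j => d i (v j)) := by
  induction n with
  | zero => simp
  | succ n ih =>
    rw [List.ofFn_succ, pairing_cons, contractLeft_ιMulti, pairing_sum, Matrix.det_succ_row_zero]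
    refine Finset.sum_congr rfl fun j _ => ?_
    rw [pairing_smul, ih]
    rfl

theorem pairing_ιMulti_of_ne {n : ℕ} (ds : List (Module.Dual S V)) (v : Fin n → V)
    (h : ds.length ≠ n) : pairing ds (ιMulti S n v) = 0 := by
  induction ds generalizing n with
  | nil =>
    obtain ⟨k, rfl⟩ : ∃ k, n = k + 1 := ⟨n - 1, by simp at h; omega⟩
    simp [ιMulti_apply, algebraMapInv]
  | cons d ds ih =>
    rw [pairing_cons]
    cases n with
    | zero => simp [ιMulti_apply, pairing_zero]
    | succ n =>
      rw [contractLeft_ιMulti, pairing_sum]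
      refine Finset.sum_eq_zero fun j _ => ?_
      rw [pairing_smul, ih _ (by simpa using h), mul_zero]

/-- `ω` is the exponential of the `2`-form with associated map `θ : V* → V`: contracting `ω` by
a functional amounts to multiplying it by a vector. The values of `pairing` on such an element
are the Pfaffians of the matrices `d j (θ (d i))`. -/
structure IsPfaffianElement (ω : ExteriorAlgebra S V) (θ : Module.Dual S V → V) : Prop where
  contract : ∀ d, contractLeft d ω = ι S (θ d) * ω
  scalar : algebraMapInv ω = 1

theorem isPfaffianElement_one : IsPfaffianElement (1 : ExteriorAlgebra S V) fun _ => 0 where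
  contract d := by simp
  scalar := by simp

theorem ι_mul_ι_swap (x y : V) : ι S x * ι S y = -(ι S y * ι S x) :=
  eq_neg_of_add_eq_zero_left (ι_add_mul_swap x y)

/-- Multiplication by `1 + x ∧ y = exp (x ∧ y)` adds `x ∧ y` to the `2`-form. -/
theorem IsPfaffianElement.mul {ω : ExteriorAlgebra S V} {θ : Module.Dual S V → V}
    (h : IsPfaffianElement ω θ) (x y : V) :
    IsPfaffianElement (ω + ι S x * (ι S y * ω)) fun d => θ d + d x • y - d y • x where
  contract d := by
    have hxx (z : ExteriorAlgebra S V) : ι S x * (ι S x * z) = 0 := by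
      rw [← mul_assoc, ι_sq_zero, zero_mul]
    have hyy (z : ExteriorAlgebra S V) : ι S y * (ι S y * z) = 0 := by
      rw [← mul_assoc, ι_sq_zero, zero_mul]
    have hsw (a b : V) (z : ExteriorAlgebra S V) :
        ι S a * (ι S b * z) = -(ι S b * (ι S a * z)) := by
      rw [← mul_assoc, ι_mul_ι_swap, neg_mul, mul_assoc]
    rw [map_add, contractLeft_ι_mul, contractLeft_ι_mul, h.contract]
    simp only [map_sub, map_add, map_smul, sub_mul, add_mul, mul_add, mul_sub, smul_mul_assoc,
      mul_smul_comm, hxx, smul_zero]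
    rw [hsw y x (ι S y * ω), hyy, hsw (θ d) x, hsw (θ d) y]
    simp only [mul_zero, neg_zero, smul_zero, mul_neg, neg_neg]
    abel
  scalar := by
    have hx : algebraMapInv (ι S x) = 0 := by simp [algebraMapInv]
    rw [map_add, map_mul, hx, zero_mul, h.scalar, add_zero]

/-- Elements of two exterior algebras that are built in parallel from `ω` and `ω'` by linear
combinations and by multiplication with vectors `v`, `v'` on which the functionals `d i` and
`c i • d' i` agree modulo `J`. -/
inductive Linked {I : Type*} (J : Ideal S) (d : I → Module.Dual S V) (d' : I → Module.Dual S V')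
    (c : I → S) (ω : ExteriorAlgebra S V) (ω' : ExteriorAlgebra S V') :
    ExteriorAlgebra S V → ExteriorAlgebra S V' → Prop
  | base : Linked J d d' c ω ω' ω ω'
  | ι_mul {x x'} (v : V) (v' : V') (hv : ∀ i, d i v - c i * d' i v' ∈ J)
      (h : Linked J d d' c ω ω' x x') : Linked J d d' c ω ω' (ι S v * x) (ι S v' * x')
  | add {x x' y y'} (hx : Linked J d d' c ω ω' x x') (hy : Linked J d d' c ω ω' y y') :
      Linked J d d' c ω ω' (x + y) (x' + y')
  | smul {x x'} (r r' : S) (hr : r - r' ∈ J) (h : Linked J d d' c ω ω' x x') :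
      Linked J d d' c ω ω' (r • x) (r' • x')

variable {I : Type*} {J : Ideal S} {d : I → Module.Dual S V} {d' : I → Module.Dual S V'}
  {c : I → S} {ω : ExteriorAlgebra S V} {ω' : ExteriorAlgebra S V'}
  {θ : Module.Dual S V → V} {θ' : Module.Dual S V' → V'}

theorem Linked.sub {x y : ExteriorAlgebra S V} {x' y' : ExteriorAlgebra S V'}
    (hx : Linked J d d' c ω ω' x x') (hy : Linked J d d' c ω ω' y y') :
    Linked J d d' c ω ω' (x - y) (x' - y') := by
  simpa [sub_eq_add_neg] using hx.add (hy.smul (-1) (-1) (by simp))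

theorem Linked.contract (hω : IsPfaffianElement ω θ) (hω' : IsPfaffianElement ω' θ')
    (H : ∀ i j, d j (θ (d i)) - c i * c j * d' j (θ' (d' i)) ∈ J) (i : I)
    {x : ExteriorAlgebra S V} {x' : ExteriorAlgebra S V'} (h : Linked J d d' c ω ω' x x') :
    Linked J d d' c ω ω' (contractLeft (d i) x) (c i • contractLeft (d' i) x') := by
  induction h with
  | base =>
    rw [hω.contract, hω'.contract, ← smul_mul_assoc, ← map_smul]
    refine Linked.base.ι_mul _ _ fun j => ?_
    convert! H i j using 1
    rw [map_smul, smul_eq_mul]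
    ring
  | ι_mul v v' hv h ih =>
    rw [contractLeft_ι_mul, contractLeft_ι_mul, smul_sub, smul_smul, ← mul_smul_comm]
    exact (h.smul _ _ (hv i)).sub (ih.ι_mul v v' hv)
  | add hx hy ihx ihy =>
    rw [map_add, map_add, smul_add]
    exact ihx.add ihy
  | smul r r' hr h ih =>
    rw [map_smul, map_smul, smul_comm (c i) r']
    exact ih.smul r r' hr

theorem Linked.algebraMapInv_sub_mem (hω : IsPfaffianElement ω θ) (hω' : IsPfaffianElement ω' θ')
    {x : ExteriorAlgebra S V} {x' : ExteriorAlgebra S V'} (h : Linked J d d' c ω ω' x x') :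
    algebraMapInv x - algebraMapInv x' ∈ J := by
  induction h with
  | base => simp [hω.scalar, hω'.scalar]
  | ι_mul v v' hv h ih => simp [algebraMapInv]
  | add hx hy ihx ihy =>
    rw [map_add, map_add, add_sub_add_comm]
    exact add_mem ihx ihy
  | @smul x x' r r' hr h ih =>
    rw [map_smul, map_smul, smul_eq_mul, smul_eq_mul]
    have : r * algebraMapInv x - r' * algebraMapInv x' =
        r * (algebraMapInv x - algebraMapInv x') + algebraMapInv x' * (r - r') := by ring
    rw [this]
    exact add_mem (J.mul_mem_left _ ih) (J.mul_mem_left _ hr)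

/-- A Pfaffian depends only on the entries of the matrix: if the two forms agree modulo `J`
on the given functionals, up to the scaling factors `c`, then so do the pairings with linked
elements. -/
theorem Linked.pairing_sub_mem (hω : IsPfaffianElement ω θ) (hω' : IsPfaffianElement ω' θ')
    (H : ∀ i j, d j (θ (d i)) - c i * c j * d' j (θ' (d' i)) ∈ J) (l : List I)
    {x : ExteriorAlgebra S V} {x' : ExteriorAlgebra S V'} (h : Linked J d d' c ω ω' x x') :
    pairing (l.map d) x - (l.map c).prod * pairing (l.map d') x' ∈ J := by
  induction l generalizing x x' with
  | nil => simpa using h.algebraMapInv_sub_mem hω hω'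
  | cons i l ih =>
    have := ih (h.contract hω hω' H i)
    rw [pairing_smul] at this
    simpa [mul_comm, mul_left_comm, mul_assoc] using this

end ExteriorAlgebra

/-! ### The Pfaffian element of the four-parameter weight -/

section WeightElement

open ExteriorAlgebra CliffordAlgebra

variable {S V : Type*} [CommRing S] [AddCommGroup V] [Module S V]

/-- The partial sum `∑_{q < M} γ_q e_q`. -/
def partialVector (γ : ℕ → S) (e : ℕ → V) (M : ℕ) : V := ∑ q ∈ Finset.range M, γ q • e q

/-- The exponential of the `2`-form `∑_{q < p < M} α_p γ_q e_p ∧ e_q`. The part of the form with a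
given `p` is `α_p e_p ∧ ∑_{q < p} γ_q e_q`, whose exponential is `1` plus this product. -/
noncomputable def weightElement (α γ : ℕ → S) (e : ℕ → V) : ℕ → ExteriorAlgebra S V
  | 0 => 1
  | p + 1 => weightElement α γ e p +
      ι S (α p • e p) * (ι S (partialVector γ e p) * weightElement α γ e p)

/-- The map `V* → V` of the `2`-form `∑_{q < p < M} α_p γ_q e_p ∧ e_q`. -/
def weightForm (α γ : ℕ → S) (e : ℕ → V) (M : ℕ) (d : Module.Dual S V) : V :=
  ∑ p ∈ Finset.range M,
    (d (α p • e p) • partialVector γ e p - d (partialVector γ e p) • α p • e p)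

theorem isPfaffianElement_weightElement (α γ : ℕ → S) (e : ℕ → V) (M : ℕ) :
    IsPfaffianElement (weightElement α γ e M) (weightForm α γ e M) := by
  induction M with
  | zero =>
    have : weightForm α γ e 0 = fun _ => (0 : V) := by
      ext d
      simp [weightForm]
    rw [this]
    exact isPfaffianElement_one
  | succ p ih =>
    have h := ih.mul (α p • e p) (partialVector γ e p)
    have : weightForm α γ e (p + 1) = fun d => weightForm α γ e p d +
        d (α p • e p) • partialVector γ e p - d (partialVector γ e p) • α p • e p := by
      ext d
      rw [weightForm, Finset.sum_range_succ, add_sub_assoc]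
      rfl
    rw [this]
    exact h

/-- The strictly decreasing lists of natural numbers less than `M`. -/
def decreasingLists : ℕ → List (List ℕ)
  | 0 => [[]]
  | p + 1 => decreasingLists p ++ (decreasingLists p).map (List.cons p)

theorem mem_decreasingLists {M : ℕ} {l : List ℕ} :
    l ∈ decreasingLists M ↔ l.Pairwise (· > ·) ∧ ∀ x ∈ l, x < M := by
  induction M generalizing l with
  | zero =>
    cases l with
    | nil => simp [decreasingLists]
    | cons x l =>
      simp only [decreasingLists, List.mem_singleton, reduceCtorEq, Nat.not_lt_zero, false_iff,
        not_and, not_forall]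
      exact fun _ => ⟨x, by simp, by simp⟩
  | succ p ih =>
    rw [decreasingLists, List.mem_append, List.mem_map, ih]
    constructor
    · rintro (⟨h1, h2⟩ | ⟨k, hk, rfl⟩)
      · exact ⟨h1, fun x hx => (h2 x hx).trans (Nat.lt_succ_self p)⟩
      · obtain ⟨h1, h2⟩ := ih.mp hk
        refine ⟨List.pairwise_cons.mpr ⟨h2, h1⟩, fun x hx => ?_⟩
        rcases List.mem_cons.mp hx with rfl | hx
        · exact Nat.lt_succ_self x
        · exact (h2 x hx).trans (Nat.lt_succ_self p)
    · rintro ⟨h1, h2⟩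
      cases l with
      | nil => exact Or.inl (by simp)
      | cons x k =>
        obtain ⟨h3, h4⟩ := List.pairwise_cons.mp h1
        rcases (Nat.lt_succ_iff.mp (h2 x (by simp))).lt_or_eq with hx | rfl
        · left
          refine ⟨h1, fun y hy => ?_⟩
          rcases List.mem_cons.mp hy with rfl | hy
          · exact hx
          · exact (h3 y hy).trans hx
        · exact Or.inr ⟨k, ih.mpr ⟨h4, h3⟩, rfl⟩

theorem nodup_decreasingLists (M : ℕ) : (decreasingLists M).Nodup := by
  induction M with
  | zero => simp [decreasingLists]
  | succ p ih =>
    rw [decreasingLists, List.nodup_append]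
    refine ⟨ih, ih.map (List.cons_injective), ?_⟩
    rintro l hl _ hk rfl
    obtain ⟨k, _, rfl⟩ := List.mem_map.mp hk
    exact lt_irrefl p ((mem_decreasingLists.mp hl).2 p (by simp))

/-- The weight of a list: the entries are weighted alternately by `γ` and `α`, the last one
by `γ`. -/
def listWeight (α γ : ℕ → S) : List ℕ → S
  | [] => 1
  | p :: l => (if Even l.length then γ p else α p) * listWeight α γ l

theorem listWeight_smul (s : S) (α γ : ℕ → S) (l : List ℕ) :
    listWeight (s • α) γ l = s ^ (l.length / 2) * listWeight α γ l := by
  induction l with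
  | nil => simp [listWeight]
  | cons p l ih =>
    rw [listWeight, listWeight, ih, List.length_cons]
    rcases Nat.even_or_odd l.length with h | h
    · have : (l.length + 1) / 2 = l.length / 2 := by obtain ⟨k, hk⟩ := h; omega
      rw [if_pos h, if_pos h, this]
      ring
    · have : (l.length + 1) / 2 = l.length / 2 + 1 := by obtain ⟨k, hk⟩ := h; omega
      rw [if_neg (Nat.not_even_iff_odd.mpr h), if_neg (Nat.not_even_iff_odd.mpr h), this,
        Pi.smul_apply, smul_eq_mul]
      ring

theorem sum_map_ite_cons {A : Type*} [AddCommMonoid A] (P : List ℕ → Prop) [DecidablePred P]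
    (L : List (List ℕ)) (f : List ℕ → A) (p : ℕ) :
    ((L.map (List.cons p)).map fun l => if P l then f l else 0).sum =
      (L.map fun l => if P (p :: l) then f (p :: l) else 0).sum := by
  rw [List.map_map]
  rfl

/-- Expanding the exponential: the even part of the sum of the weighted products over all
decreasing lists is `weightElement`, and the odd part is its product with `partialVector`. -/
theorem sum_decreasingLists (α γ : ℕ → S) (e : ℕ → V) (M : ℕ) :
    ((decreasingLists M).map fun l => if Even l.length then
        listWeight α γ l • (l.map fun p => ι S (e p)).prod else 0).sum = weightElement α γ e M ∧
    ((decreasingLists M).map fun l => if ¬ Even l.length then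
        listWeight α γ l • (l.map fun p => ι S (e p)).prod else 0).sum =
      ι S (partialVector γ e M) * weightElement α γ e M := by
  induction M with
  | zero => simp [decreasingLists, listWeight, weightElement, partialVector]
  | succ p ih =>
    have hκ : partialVector γ e (p + 1) = partialVector γ e p + γ p • e p :=
      Finset.sum_range_succ _ _
    have h1 : (fun l : List ℕ => if Even (p :: l).length then
        listWeight α γ (p :: l) • ((p :: l).map fun p => ι S (e p)).prod else 0) =
        fun l => ι S (α p • e p) * (if ¬ Even l.length then
          listWeight α γ l • (l.map fun p => ι S (e p)).prod else 0) := by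
      ext1 l
      by_cases h : Even l.length
      · simp [h, Nat.even_add_one]
      · simp [h, Nat.even_add_one, listWeight, smul_smul, mul_comm]
    have h2 : (fun l : List ℕ => if ¬ Even (p :: l).length then
        listWeight α γ (p :: l) • ((p :: l).map fun p => ι S (e p)).prod else 0) =
        fun l => ι S (γ p • e p) * (if Even l.length then
          listWeight α γ l • (l.map fun p => ι S (e p)).prod else 0) := by
      ext1 l
      by_cases h : Even l.length
      · simp [h, Nat.even_add_one, listWeight, smul_smul, mul_comm]
      · simp [h, Nat.even_add_one]
    constructor
    · rw [decreasingLists, List.map_append, List.sum_append, ih.1, sum_map_ite_cons, h1,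
        List.sum_map_mul_left, ih.2]
      rfl
    · rw [decreasingLists, List.map_append, List.sum_append, ih.2, sum_map_ite_cons, h2,
        List.sum_map_mul_left, ih.1, hκ]
      have hκκ (z : ExteriorAlgebra S V) :
          ι S (partialVector γ e p) * (ι S (partialVector γ e p) * z) = 0 := by
        rw [← mul_assoc, ι_sq_zero, zero_mul]
      have hee (z : ExteriorAlgebra S V) : ι S (e p) * (ι S (e p) * z) = 0 := by
        rw [← mul_assoc, ι_sq_zero, zero_mul]
      have hκe : ι S (partialVector γ e p) *
          (ι S (e p) * (ι S (partialVector γ e p) * weightElement α γ e p)) = 0 := by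
        rw [← mul_assoc, ι_mul_ι_swap, neg_mul, mul_assoc, hκκ, mul_zero, neg_zero]
      rw [weightElement]
      simp only [map_add, map_smul, add_mul, mul_add, smul_mul_assoc, mul_smul_comm, hee, hκe,
        smul_zero, add_zero]

theorem prod_map_ι (e : ℕ → V) (l : List ℕ) :
    (l.map fun p => ι S (e p)).prod = ιMulti S l.length fun j => e (l.getD j 0) := by
  rw [ιMulti_apply]
  congr 1
  refine List.ext_getElem (by simp) fun i h1 h2 => ?_
  simp

/-- The minor summation formula: a Pfaffian of the truncated `2`-form is the weighted sum of
determinants over decreasing lists. -/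
theorem pairing_weightElement (α γ : ℕ → S) (e : ℕ → V) (M : ℕ) {N : ℕ} (hN : Even N)
    (d : Fin N → Module.Dual S V) :
    pairing (List.ofFn d) (weightElement α γ e M) =
      ∑ l ∈ (decreasingLists M).toFinset with l.length = N,
        listWeight α γ l * Matrix.det (Matrix.of fun i j : Fin N => d i (e (l.getD j 0))) := by
  rw [← (sum_decreasingLists α γ e M).1, pairing_listSum, List.map_map, Finset.sum_filter,
    List.sum_toFinset _ (nodup_decreasingLists M)]
  congr 1
  refine List.map_congr_left fun l _ => ?_
  by_cases hl : l.length = N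
  · subst hl
    simp only [Function.comp_apply, if_pos hN, if_true]
    rw [pairing_smul, prod_map_ι, pairing_ιMulti]
  · simp only [Function.comp_apply, if_neg hl]
    split_ifs
    · rw [pairing_smul, prod_map_ι, pairing_ιMulti_of_ne, mul_zero]
      simpa using Ne.symm hl
    · exact pairing_zero _

theorem pairing_weightElement_smul (s : S) (α γ : ℕ → S) (e : ℕ → V) (M m : ℕ)
    (d : Fin (2 * m) → Module.Dual S V) :
    pairing (List.ofFn d) (weightElement (s • α) γ e M) =
      s ^ m * pairing (List.ofFn d) (weightElement α γ e M) := by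
  rw [pairing_weightElement _ _ _ _ (even_two_mul m),
    pairing_weightElement _ _ _ _ (even_two_mul m), Finset.mul_sum]
  refine Finset.sum_congr rfl fun l hl => ?_
  rw [listWeight_smul, (Finset.mem_filter.mp hl).2, Nat.mul_div_cancel_left _ two_pos, mul_assoc]

end WeightElement

/-! ### Schur expansion as a limit of Pfaffians -/

section Weights

/-- The weight `α_p = a^⌊p/2⌋ b^⌊(p-1)/2⌋` of an odd-indexed part of a shifted partition with an
even number of parts. Such a part is positive; the value `1` at `p = 0` only ever multiplies empty
sums. -/
def alphaWeight {R : Type*} [CommRing R] (a b : R) (p : ℕ) : R := a ^ (p / 2) * b ^ ((p - 1) / 2)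

/-- The weight `γ_q = c^⌈q/2⌉ d^⌊q/2⌋` of an even-indexed part of a shifted partition. -/
def gammaWeight {R : Type*} [CommRing R] (c d : R) (q : ℕ) : R := c ^ ((q + 1) / 2) * d ^ (q / 2)

variable {R : Type*} [CommRing R]

theorem listWeight_ofFn (α γ : ℕ → R) (m : ℕ) (g : ℕ → ℕ) :
    listWeight α γ (List.ofFn fun j : Fin (2 * m) => g j) =
      ∏ i ∈ Finset.range m, α (g (2 * i)) * γ (g (2 * i + 1)) := by
  induction m generalizing g with
  | zero => simp [listWeight]
  | succ m ih =>
    have h : List.ofFn (fun j : Fin (2 * (m + 1)) => g j) =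
        g 0 :: g 1 :: List.ofFn (fun j : Fin (2 * m) => g (j + 2)) := by
      change List.ofFn (fun j : Fin (2 * m + 1 + 1) => g j) = _
      rw [List.ofFn_succ, List.ofFn_succ]
      rfl
    rw [h, listWeight, listWeight, ih fun j => g (j + 2), Finset.prod_range_succ']
    simp only [List.length_cons, List.length_ofFn, Nat.even_add_one, even_two_mul, not_true,
      if_true, if_false, mul_zero, zero_add, mul_add, mul_one, add_right_comm _ 2 1]
    ring

theorem map_listWeight {S : Type*} [CommRing S] (f : R →+* S) (α γ : ℕ → R) (l : List ℕ) :
    f (listWeight α γ l) = listWeight (fun p => f (α p)) (fun p => f (γ p)) l := by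
  induction l with
  | nil => simp [listWeight]
  | cons p l ih =>
    rw [listWeight, listWeight, map_mul, ih]
    split_ifs <;> rfl

/-- The sums in the definition of `omegaWeight` may be taken over any range that covers all the
parts. -/
theorem sum_range_rowLen (lam : YoungDiagram) {m : ℕ} (hl : lam.colLen 0 ≤ 2 * m) (F : ℕ → ℕ)
    (hF : F 0 = 0) (k : ℕ) :
    ∑ i ∈ Finset.range (lam.colLen 0), F (lam.rowLen (2 * i + k)) =
      ∑ i ∈ Finset.range m, F (lam.rowLen (2 * i + k)) := by
  have h (n : ℕ) (hn : ∀ i, n ≤ i → lam.colLen 0 ≤ 2 * i + k) :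
      ∑ i ∈ Finset.range n, F (lam.rowLen (2 * i + k)) =
        ∑ i ∈ Finset.range (max (lam.colLen 0) m), F (lam.rowLen (2 * i + k)) ∨
      max (lam.colLen 0) m < n := by
    rcases le_or_gt n (max (lam.colLen 0) m) with h | h
    · left
      refine Finset.sum_subset (Finset.range_mono h) fun i _ hi => ?_
      rw [(rowLen_eq_zero_iff lam _).mpr (hn i (by simpa using hi)), hF]
    · exact Or.inr h
  have h1 := (h (lam.colLen 0) fun i hi => by omega).resolve_right (by simp)
  have h2 := (h m fun i hi => by omega).resolve_right (by simp)
  rw [h1, h2]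

/-- The weight of a shifted partition with an even number `2 m` of parts. -/
theorem listWeight_shiftedParts (a b c d : R) {m : ℕ} {lam : YoungDiagram}
    (hl : lam.colLen 0 ≤ 2 * m) :
    listWeight (alphaWeight a b) (gammaWeight c d) (List.ofFn (shiftedParts (2 * m) lam)) =
      (a * b * c * d) ^ (∑ i ∈ Finset.range m, i) * omegaWeight a b c d lam := by
  have h := listWeight_ofFn (alphaWeight a b) (gammaWeight c d) m
    fun j => lam.rowLen j + (2 * m - 1 - j)
  have e1 := sum_range_rowLen lam hl (fun r => (r + 1) / 2) rfl 0
  have e2 := sum_range_rowLen lam hl (fun r => r / 2) rfl 0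
  have e3 := sum_range_rowLen lam hl (fun r => (r + 1) / 2) rfl 1
  have e4 := sum_range_rowLen lam hl (fun r => r / 2) rfl 1
  simp only [add_zero] at e1 e2 e3 e4
  change listWeight _ _ (List.ofFn (shiftedParts (2 * m) lam)) = _ at h
  rw [h, omegaWeight, e1, e2, e3, e4, ← Finset.sum_range_reflect]
  simp only [← Finset.prod_pow_eq_pow_sum, ← Finset.prod_mul_distrib]
  refine Finset.prod_congr rfl fun i hi => ?_
  have hi' := Finset.mem_range.mp hi
  rw [alphaWeight, gammaWeight]
  -- in `δ`, the entry at an odd-indexed part is odd and the next one is even, so that the shift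
  -- adds `m - 1 - i` to each of the four exponents
  have f1 : (lam.rowLen (2 * i) + (2 * m - 1 - 2 * i)) / 2 =
      (lam.rowLen (2 * i) + 1) / 2 + (m - 1 - i) := by omega
  have f2 : (lam.rowLen (2 * i) + (2 * m - 1 - 2 * i) - 1) / 2 =
      lam.rowLen (2 * i) / 2 + (m - 1 - i) := by omega
  have f3 : (lam.rowLen (2 * i + 1) + (2 * m - 1 - (2 * i + 1)) + 1) / 2 =
      (lam.rowLen (2 * i + 1) + 1) / 2 + (m - 1 - i) := by omega
  have f4 : (lam.rowLen (2 * i + 1) + (2 * m - 1 - (2 * i + 1))) / 2 =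
      lam.rowLen (2 * i + 1) / 2 + (m - 1 - i) := by omega
  rw [f1, f2, f3, f4]
  ring

end Weights

section Bijection

theorem shiftedParts_strictAnti (N : ℕ) (lam : YoungDiagram) {i j : Fin N} (hij : i < j) :
    shiftedParts N lam j < shiftedParts N lam i := by
  have h1 := lam.rowLen_anti i j hij.le
  have h2 : (i : ℕ) < j := hij
  have h3 := j.isLt
  simp only [shiftedParts, staircase]
  omega

theorem shiftedParts_injOn (N : ℕ) :
    Set.InjOn (shiftedParts N) {lam | lam.colLen 0 ≤ N} := by
  intro lam hlam mu hmu h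
  have hr : ∀ i, lam.rowLen i = mu.rowLen i := by
    intro i
    rcases lt_or_ge i N with hi | hi
    · have := congrFun h ⟨i, hi⟩
      simpa [shiftedParts] using this
    · rw [(rowLen_eq_zero_iff lam i).mpr (le_trans hlam hi),
        (rowLen_eq_zero_iff mu i).mpr (le_trans hmu hi)]
  ext ⟨i, j⟩
  rw [YoungDiagram.mem_cells, YoungDiagram.mem_cells, YoungDiagram.mem_iff_lt_rowLen,
    YoungDiagram.mem_iff_lt_rowLen, hr]

/-- Every strictly decreasing sequence of length `N` is a shifted partition. -/
theorem exists_shiftedParts_eq {N : ℕ} (g : Fin N → ℕ) (hg : ∀ i j, i < j → g j < g i) :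
    ∃ lam : YoungDiagram, lam.colLen 0 ≤ N ∧ shiftedParts N lam = g := by
  have key : ∀ (k : ℕ) (i j : Fin N), (j : ℕ) = i + k → g j + k ≤ g i := by
    intro k
    induction k with
    | zero =>
      intro i j h
      have : j = i := Fin.ext (by simpa using h)
      simp [this]
    | succ k ih =>
      intro i j h
      have hj := j.isLt
      have h1 := ih i ⟨i + k, by omega⟩ rfl
      have h2 := hg ⟨i + k, by omega⟩ j (by rw [Fin.lt_def]; simp only; omega)
      omega
  have hge : ∀ j : Fin N, N - 1 - j ≤ g j := by
    intro j
    have hj := j.isLt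
    have := key (N - 1 - j) j ⟨N - 1, by omega⟩ (by simp only; omega)
    omega
  let w : List ℕ := List.ofFn fun j : Fin N => g j - (N - 1 - j)
  have hw : w.SortedGE := by
    refine List.Pairwise.sortedGE ?_
    rw [List.pairwise_ofFn]
    intro i j hij
    have h1 : (i : ℕ) < j := hij
    have h2 := key (j - i) i j (by omega)
    have h3 := hge j
    have hj := j.isLt
    change g j - (N - 1 - j) ≤ g i - (N - 1 - i)
    omega
  have hlen : w.length = N := by simp [w]
  refine ⟨YoungDiagram.ofRowLens w hw, ?_, ?_⟩
  · rw [← rowLen_eq_zero_iff]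
    by_contra h
    obtain ⟨h1, _⟩ := YoungDiagram.mem_ofRowLens.mp
      (YoungDiagram.mem_iff_lt_rowLen.mpr (Nat.pos_of_ne_zero h))
    simp [hlen] at h1
  · ext j
    have h1 := YoungDiagram.rowLen_ofRowLens (hw := hw) ⟨j, by rw [hlen]; exact j.isLt⟩
    have h2 := hge j
    have h3 : w.get ⟨j, by rw [hlen]; exact j.isLt⟩ = g j - (N - 1 - j) := by simp [w]
    replace h1 : (YoungDiagram.ofRowLens w hw).rowLen j = g j - (N - 1 - j) := h1.trans h3
    simp only [shiftedParts, staircase, h1]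
    omega

/-- Boxed partitions: those with at most `M` parts, all of them at most `M - N`. If there are at
most `N` parts, then the parts of the shifted partition are less than `M`. -/
theorem finite_setOf_boxed (N M : ℕ) :
    {lam : YoungDiagram | lam.colLen 0 ≤ M ∧ lam.rowLen 0 + N ≤ M}.Finite := by
  refine Set.Finite.of_finite_image (f := YoungDiagram.cells)
    ((Finset.range M ×ˢ Finset.range M).powerset.finite_toSet.subset ?_)
    fun _ _ _ _ h => YoungDiagram.ext h
  rintro _ ⟨lam, ⟨h1, h2⟩, rfl⟩
  simp only [Finset.coe_powerset, Set.mem_preimage, Set.mem_powerset_iff]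
  rintro ⟨i, j⟩ hij
  have hij' : (i, j) ∈ lam := by simpa using hij
  have h3 := YoungDiagram.mem_iff_lt_colLen.mp (lam.up_left_mem le_rfl (Nat.zero_le j) hij')
  have h4 := YoungDiagram.mem_iff_lt_rowLen.mp (lam.up_left_mem (Nat.zero_le i) le_rfl hij')
  simp only [Finset.coe_product, Finset.coe_range, Set.mem_prod, Set.mem_Iio]
  omega

/-- Shifting by `δ` is a bijection from boxed partitions with at most `N` parts to decreasing lists
of length `N`. -/
theorem sum_boxed_eq_sum_decreasingLists {A : Type*} [AddCommMonoid A] {N M : ℕ} (hNM : N ≤ M)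
    (F : List ℕ → A) :
    ∑ lam ∈ (finite_setOf_boxed N M).toFinset,
        (if lam.colLen 0 ≤ N then F (List.ofFn (shiftedParts N lam)) else 0) =
      ∑ l ∈ (decreasingLists M).toFinset with l.length = N, F l := by
  rw [← Finset.sum_filter]
  refine Finset.sum_nbij (fun lam => List.ofFn (shiftedParts N lam)) ?_ ?_ ?_ fun _ _ => rfl
  · intro lam hlam
    simp only [Finset.mem_filter, Set.Finite.mem_toFinset, Set.mem_ofPred_eq] at hlam
    simp only [Finset.mem_filter, List.mem_toFinset, List.length_ofFn, and_true]
    refine mem_decreasingLists.mpr ⟨?_, ?_⟩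
    · rw [List.pairwise_ofFn]
      exact fun i j hij => shiftedParts_strictAnti N lam hij
    · intro x hx
      obtain ⟨j, rfl⟩ := List.mem_ofFn.mp hx
      have h1 := lam.rowLen_anti 0 j (Nat.zero_le _)
      have h2 := j.isLt
      simp only [shiftedParts, staircase]
      omega
  · intro lam hlam mu hmu h
    simp only [Finset.coe_filter, Set.Finite.mem_toFinset, Set.mem_ofPred_eq] at hlam hmu
    exact shiftedParts_injOn N hlam.2 hmu.2 (List.ofFn_injective h)
  · intro l hl
    simp only [Finset.coe_filter, List.mem_toFinset, Set.mem_ofPred_eq] at hl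
    obtain ⟨hl, rfl⟩ := hl
    obtain ⟨h1, h2⟩ := mem_decreasingLists.mp hl
    obtain ⟨lam, h3, h4⟩ := exists_shiftedParts_eq (fun j : Fin l.length => l.get j)
      fun i j hij => List.pairwise_iff_get.mp h1 i j hij
    refine ⟨lam, ?_, (congrArg List.ofFn h4).trans (List.ofFn_get l)⟩
    simp only [Finset.coe_filter, Set.Finite.mem_toFinset, Set.mem_ofPred_eq]
    refine ⟨⟨h3.trans hNM, ?_⟩, h3⟩
    rcases Nat.eq_zero_or_pos l.length with h0 | h0
    · rw [(rowLen_eq_zero_iff lam 0).mpr (h0 ▸ h3)]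
      omega
    · have h5 := congrFun h4 ⟨0, h0⟩
      have h6 := h2 (l.get ⟨0, h0⟩) (List.get_mem l _)
      simp only [shiftedParts, staircase] at h5
      omega

theorem tendsto_boxed (N : ℕ) :
    Filter.Tendsto (fun M => (finite_setOf_boxed N M).toFinset) Filter.atTop Filter.atTop := by
  refine Filter.tendsto_atTop_finset_of_monotone ?_ fun lam =>
    ⟨lam.colLen 0 + lam.rowLen 0 + N, ?_⟩
  · intro M M' h lam hlam
    simp only [Set.Finite.mem_toFinset, Set.mem_ofPred_eq] at hlam ⊢
    omega
  · simp only [Set.Finite.mem_toFinset, Set.mem_ofPred_eq]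
    omega

end Bijection

section Limit

variable {R : Type*} [CommRing R]

/-- The Pfaffian attached to the tuple `u` and the truncation at `M` of the `2`-form with
coefficients `α_p γ_q`: the vectors are `e_p = (u_i ^ p)_i`, and the form is contracted by all the
coordinate functionals. -/
noncomputable def truncatedPfaffian {S : Type*} [CommRing S] {N : ℕ} (α γ : ℕ → S) (u : Fin N → S)
    (M : ℕ) : S :=
  pairing (List.ofFn fun i : Fin N => (LinearMap.proj i : (Fin N → S) →ₗ[S] S))
    (weightElement α γ (fun p i => u i ^ p) M)

/-- The bialternant form of the weighted sum of Schur functions in `2 m` variables, as a limit of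
Pfaffians. -/
theorem tendsto_truncatedPfaffian [TopologicalSpace R] [DiscreteTopology R] (a b c d : R) (m : ℕ)
    {u : ℕ → MvPowerSeries ℕ R} (hu0 : ∀ i, MvPowerSeries.constantCoeff (u i) = 0)
    (hu : ∀ i, 2 * m ≤ i → u i = 0) :
    Filter.Tendsto (truncatedPfaffian (fun p => MvPowerSeries.C (alphaWeight a b p))
        (fun p => MvPowerSeries.C (gammaWeight c d p)) fun i : Fin (2 * m) => u i) Filter.atTop
      (nhds (MvPowerSeries.C ((a * b * c * d) ^ (∑ i ∈ Finset.range m, i)) *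
        (∏ i : Fin (2 * m), ∏ j ∈ Finset.Ioi i, (u i - u j)) *
        MvPowerSeries.subst u (schurSum a b c d))) := by
  have hsub := hasSubst_of_eventually_zero hu0 hu
  have h1 := ((hasSum_schurSum a b c d).subst_mvPowerSeries hsub).mul_left
    (MvPowerSeries.C ((a * b * c * d) ^ (∑ i ∈ Finset.range m, i)) *
      (∏ i : Fin (2 * m), ∏ j ∈ Finset.Ioi i, (u i - u j)))
  have h2 := Filter.Tendsto.comp h1 (tendsto_boxed (2 * m))
  refine h2.congr' ?_
  filter_upwards [Filter.eventually_ge_atTop (2 * m)] with M hM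
  rw [truncatedPfaffian, pairing_weightElement _ _ _ _ (even_two_mul m),
    ← sum_boxed_eq_sum_decreasingLists hM]
  refine Finset.sum_congr rfl fun lam _ => ?_
  rw [MvPowerSeries.subst_smul hsub, subst_schur hsub hu]
  split_ifs with hl
  · have h3 := congrArg (MvPolynomial.aeval fun i : Fin (2 * m) => u i)
      (alternant_eq_mul_schurPoly (2 * m) lam)
    rw [map_mul, aeval_alternant, aeval_alternant, det_staircase] at h3
    have h4 := congrArg (MvPowerSeries.C (σ := ℕ) (R := R)) (listWeight_shiftedParts a b c d hl)
    rw [map_listWeight, map_mul] at h4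
    rw [h4, MvPowerSeries.smul_eq_C_mul]
    have h5 : Matrix.det (Matrix.of fun i j : Fin (2 * m) =>
        (LinearMap.proj i : (Fin (2 * m) → MvPowerSeries ℕ R) →ₗ[MvPowerSeries ℕ R] _)
          fun i => u i ^ ((List.ofFn (shiftedParts (2 * m) lam)).getD j 0)) =
        Matrix.det (Matrix.of fun i j : Fin (2 * m) => u i ^ shiftedParts (2 * m) lam j) := by
      congr 1
      ext1 i j
      simp
    rw [h5, h3]
    ring
  · rw [smul_zero, mul_zero]

end Limit

/-! ### Specialising two variables to `t` and `-t` -/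

section ClosedForm

variable {S : Type*} [CommRing S]

theorem gammaWeight_partialSum (c d y : S) (M : ℕ) :
    ∑ q ∈ Finset.range (M + 2), gammaWeight c d q * y ^ q =
      1 + c * y + c * d * y ^ 2 * ∑ q ∈ Finset.range M, gammaWeight c d q * y ^ q := by
  rw [Finset.sum_range_succ', Finset.sum_range_succ', Finset.mul_sum]
  have h (q : ℕ) : gammaWeight c d (q + 1 + 1) * y ^ (q + 1 + 1) =
      c * d * y ^ 2 * (gammaWeight c d q * y ^ q) := by
    have h1 : (q + 1 + 1 + 1) / 2 = (q + 1) / 2 + 1 := by omega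
    have h2 : (q + 1 + 1) / 2 = q / 2 + 1 := by omega
    rw [gammaWeight, gammaWeight, h1, h2]
    ring
  simp only [h]
  simp [gammaWeight]
  ring

theorem alphaWeight_add_three (a b : S) (p : ℕ) :
    alphaWeight a b (p + 3) = a * b * alphaWeight a b (p + 1) := by
  have h1 : (p + 3) / 2 = (p + 1) / 2 + 1 := by omega
  have h2 : (p + 3 - 1) / 2 = (p + 1 - 1) / 2 + 1 := by omega
  rw [alphaWeight, alphaWeight, h1, h2]
  ring

theorem alphaWeight_partialSum (a b x : S) (M : ℕ) :
    ∑ p ∈ Finset.range (M + 2), alphaWeight a b (p + 1) * x ^ (p + 1) =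
      x + a * x ^ 2 +
        a * b * x ^ 2 * ∑ p ∈ Finset.range M, alphaWeight a b (p + 1) * x ^ (p + 1) := by
  rw [Finset.sum_range_succ', Finset.sum_range_succ', Finset.mul_sum]
  have h (p : ℕ) : alphaWeight a b (p + 1 + 1 + 1) * x ^ (p + 1 + 1 + 1) =
      a * b * x ^ 2 * (alphaWeight a b (p + 1) * x ^ (p + 1)) := by
    rw [alphaWeight_add_three]
    ring
  simp only [h]
  simp [alphaWeight]
  ring

/-- The generating function `∑_{p ≥ 1} α_p x ^ p` is `(x + a x²) / (1 - a b x²)`, modulo powers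
of `x`. -/
theorem pow_dvd_sub_alphaWeight_partialSum {a b x f : S}
    (hf : (1 - a * b * x ^ 2) * f = x + a * x ^ 2) (M : ℕ) :
    x ^ (M + 1) ∣ f - ∑ p ∈ Finset.range M, alphaWeight a b (p + 1) * x ^ (p + 1) := by
  induction M using Nat.twoStepInduction with
  | zero => exact ⟨1 + a * x + a * b * x * f, by simp; linear_combination hf⟩
  | one => exact ⟨a + a * b * f, by simp [alphaWeight]; linear_combination hf⟩
  | more M ih _ =>
    obtain ⟨h, hh⟩ := ih
    refine ⟨a * b * h, ?_⟩
    rw [alphaWeight_partialSum]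
    linear_combination hf + a * b * x ^ 2 * hh

/-- The partial sum of `∑_{q < p} α_p γ_q x ^ p y ^ q` over `p < M`. -/
def pairSum (a b c d x y : S) (M : ℕ) : S :=
  ∑ p ∈ Finset.range M,
    alphaWeight a b p * x ^ p * ∑ q ∈ Finset.range p, gammaWeight c d q * y ^ q

theorem pairSum_add_two (a b c d x y : S) (M : ℕ) :
    pairSum a b c d x y (M + 2) =
      (∑ p ∈ Finset.range (M + 1), alphaWeight a b (p + 1) * x ^ (p + 1)) * (1 + c * y)
        - c * x * y + a * b * c * d * x ^ 2 * y ^ 2 * pairSum a b c d x y M := by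
  induction M with
  | zero => simp [pairSum, Finset.sum_range_succ, alphaWeight, gammaWeight]; ring
  | succ M ih =>
    have hp (M : ℕ) : pairSum a b c d x y (M + 1) = pairSum a b c d x y M +
        alphaWeight a b M * x ^ M * ∑ q ∈ Finset.range M, gammaWeight c d q * y ^ q :=
      Finset.sum_range_succ _ _
    rw [show M + 1 + 2 = M + 2 + 1 from rfl, hp (M + 2), ih, gammaWeight_partialSum,
      Finset.sum_range_succ _ (M + 1), hp M]
    cases M with
    | zero => simp; ring
    | succ M =>
      rw [show M + 1 + 2 = M + 3 from rfl, show M + 1 + 1 + 1 = M + 3 from rfl,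
        alphaWeight_add_three]
      ring

/-- The generating function `∑_{q < p} α_p γ_q x ^ p y ^ q` is the rational function
`(f (1 + c y) - c x y) / (1 - a b c d x² y²)` with `f = (x + a x²) / (1 - a b x²)`, modulo powers of
`x`. -/
theorem pow_dvd_sub_pairSum {a b c d x y f k : S}
    (hf : (1 - a * b * x ^ 2) * f = x + a * x ^ 2)
    (hk : (1 - a * b * c * d * x ^ 2 * y ^ 2) * k = 1) (M : ℕ) :
    x ^ M ∣ (f * (1 + c * y) - c * x * y) * k - pairSum a b c d x y M := by
  induction M using Nat.twoStepInduction with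
  | zero => simp
  | one =>
    obtain ⟨h, hh⟩ := pow_dvd_sub_alphaWeight_partialSum hf 0
    refine ⟨(h * (1 + c * y) - c * y) * k, ?_⟩
    simp only [Finset.range_zero, Finset.sum_empty] at hh
    simp only [pairSum, Finset.sum_range_one, Finset.range_zero, Finset.sum_empty]
    linear_combination (1 + c * y) * k * hh
  | more M ih _ =>
    obtain ⟨h, hh⟩ := ih
    obtain ⟨g, hg⟩ := pow_dvd_sub_alphaWeight_partialSum hf (M + 1)
    refine ⟨g * (1 + c * y) + a * b * c * d * y ^ 2 * h, ?_⟩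
    rw [pairSum_add_two]
    linear_combination (f * (1 + c * y) - c * x * y) * hk + (1 + c * y) * hg +
      a * b * c * d * x ^ 2 * y ^ 2 * hh

end ClosedForm

section Reduction

open ExteriorAlgebra CliffordAlgebra

variable {S : Type*} [CommRing S]

theorem weightForm_smul {V : Type*} [AddCommGroup V] [Module S V] (s : S) (α γ : ℕ → S)
    (e : ℕ → V) (M : ℕ) (δ : Module.Dual S V) :
    weightForm (s • α) γ e M δ = s • weightForm α γ e M δ := by
  rw [weightForm, weightForm, Finset.smul_sum]
  refine Finset.sum_congr rfl fun p _ => ?_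
  simp only [Pi.smul_apply, smul_eq_mul, map_smul, smul_sub, smul_smul]
  congr 2 <;> ring

theorem weightForm_proj (a b c d : S) {N : ℕ} (u : Fin N → S) (M : ℕ) (i j : Fin N) :
    weightForm (alphaWeight a b) (gammaWeight c d) (fun p i => u i ^ p) M (LinearMap.proj i) j =
      pairSum a b c d (u i) (u j) M - pairSum a b c d (u j) (u i) M := by
  rw [weightForm, Finset.sum_apply, pairSum, pairSum, ← Finset.sum_sub_distrib]
  refine Finset.sum_congr rfl fun p _ => ?_
  simp only [partialVector, LinearMap.coe_proj, Function.eval, Pi.sub_apply, Pi.smul_apply,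
    Finset.sum_apply, smul_eq_mul]
  ring

/-- The entries of the matrix whose Pfaffian is taken, modulo an ideal containing all `u_i ^ M`. -/
theorem weightForm_proj_sub_mem {a b c d : S} {N : ℕ} {u f : Fin N → S}
    (hf : ∀ i, (1 - a * b * u i ^ 2) * f i = u i + a * u i ^ 2) (M : ℕ) {J : Ideal S}
    (hJ : ∀ i, u i ^ M ∈ J) (i j : Fin N) {k : S}
    (hk : (1 - a * b * c * d * u i ^ 2 * u j ^ 2) * k = 1) :
    weightForm (alphaWeight a b) (gammaWeight c d) (fun p i => u i ^ p) M (LinearMap.proj i) j -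
      (f i * (1 + c * u j) - f j * (1 + c * u i)) * k ∈ J := by
  have h1 := J.mem_of_dvd (pow_dvd_sub_pairSum (hf i) hk M) (hJ i)
  have hk' : (1 - a * b * c * d * u j ^ 2 * u i ^ 2) * k = 1 := by
    linear_combination hk
  have h2 := J.mem_of_dvd (pow_dvd_sub_pairSum (hf j) hk' M) (hJ j)
  rw [weightForm_proj]
  convert! sub_mem h2 h1 using 1
  ring

/-- Setting two variables to `t` and `-t` splits off an explicit factor from the Pfaffian. The
rows `0` and `1` are, modulo `J`, combinations of the two vectors `r` and `q` below; eliminating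
them multiplies the remaining entries of the matrix by
`a b c d (u_i² - t²) (u_j² - t²) / ((1 - a b c d t² u_i²) (1 - a b c d t² u_j²))`. -/
theorem truncatedPfaffian_sub_mem {a b c d t : S} {n : ℕ} {u f : Fin (n + 2) → S}
    {k : Fin (n + 2) → Fin (n + 2) → S} (h0 : u 0 = t) (h1 : u 1 = -t)
    (hf : ∀ i, (1 - a * b * u i ^ 2) * f i = u i + a * u i ^ 2)
    (hk : ∀ i j, (1 - a * b * c * d * u i ^ 2 * u j ^ 2) * k i j = 1) (M : ℕ) {J : Ideal S}
    (hJ : ∀ i, u i ^ M ∈ J) :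
    truncatedPfaffian (alphaWeight a b) (gammaWeight c d) u M -
      (f 0 * (1 - c * t) - f 1 * (1 + c * t)) * k 0 0 *
        (∏ i : Fin n, (u i.succ.succ ^ 2 - t ^ 2) * k 0 i.succ.succ) *
        truncatedPfaffian ((a * b * c * d) • alphaWeight a b) (gammaWeight c d)
          (fun i : Fin n => u i.succ.succ) M ∈ J := by
  set s := a * b * c * d with hs
  set D := f 0 * (1 - c * t) - f 1 * (1 + c * t) with hD
  have hk0 (j) : (1 - s * t ^ 2 * u j ^ 2) * k 0 j = 1 := by
    have h := hk 0 j
    rwa [h0] at h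
  have hk1 (j) : k 1 j = k 0 j := by
    have h := hk 1 j
    rw [h1, neg_sq] at h
    linear_combination k 0 j * h - k 1 j * hk0 j
  have hk01 : k 0 1 = k 0 0 := by
    have h := hk0 1
    have h' := hk0 0
    rw [h1, neg_sq] at h
    rw [h0] at h'
    linear_combination k 0 0 * h - k 0 1 * h'
  let pr (i : Fin (n + 2)) : Module.Dual S (Fin (n + 2) → S) := LinearMap.proj i
  let r : Fin (n + 2) → S := fun j => f j * k 0 j
  let q : Fin (n + 2) → S := fun j => (1 + c * u j) * k 0 j
  let r' : Fin (n + 2) → S := (-(1 - s * t ^ 4)) • r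
  set ω := weightElement (alphaWeight a b) (gammaWeight c d) (fun p i => u i ^ p) M with hω
  set θ := weightForm (alphaWeight a b) (gammaWeight c d) (fun p i => u i ^ p) M with hθ
  have hpf : IsPfaffianElement ω θ := isPfaffianElement_weightElement _ _ _ M
  have hform (i j) : pr j (θ (pr i)) - (f i * (1 + c * u j) - f j * (1 + c * u i)) * k i j ∈ J :=
    weightForm_proj_sub_mem hf M hJ i j (hk i j)
  have hrow0 (j) : pr j (θ (pr 0)) - 1 * pr j (f 0 • q - (1 + c * t) • r) ∈ J := by
    convert! hform 0 j using 2
    simp only [pr, r, q, LinearMap.coe_proj, Function.eval, Pi.sub_apply, Pi.smul_apply,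
      smul_eq_mul, h0]
    ring
  have hrow1 (j) : pr j (θ (pr 1)) - 1 * pr j (f 1 • q - (1 - c * t) • r) ∈ J := by
    convert! hform 1 j using 2
    simp only [pr, r, q, LinearMap.coe_proj, Function.eval, Pi.sub_apply, Pi.smul_apply,
      smul_eq_mul, h1, hk1]
    ring
  have h01 : pr 1 (θ (pr 0)) - D * k 0 0 ∈ J := by
    convert! hform 0 1 using 2
    rw [h0, h1, hk01, hD]
    ring
  have hself (i j) : pr j (θ (pr i)) - 1 * 1 * pr j (θ (pr i)) ∈ J := by simp
  have hlink : Linked J pr pr (fun _ => 1) ω ω (contractLeft (pr 1) (contractLeft (pr 0) ω))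
      ((D * k 0 0) • (ω + ι S r' * (ι S q * ω))) := by
    have e1 : contractLeft (pr 1) (contractLeft (pr 0) ω) =
        pr 1 (θ (pr 0)) • ω - ι S (θ (pr 0)) * (ι S (θ (pr 1)) * ω) := by
      rw [hpf.contract, contractLeft_ι_mul, hpf.contract]
    have e2 : (D * k 0 0) • (ω + ι S r' * (ι S q * ω)) = (D * k 0 0) • ω -
        ι S (f 0 • q - (1 + c * t) • r) * (ι S (f 1 • q - (1 - c * t) • r) * ω) := by
      have hxx (x : Fin (n + 2) → S) (z : ExteriorAlgebra S (Fin (n + 2) → S)) :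
          ι S x * (ι S x * z) = 0 := by
        rw [← mul_assoc, ι_sq_zero, zero_mul]
      have hsw : ι S q * (ι S r * ω) = -(ι S r * (ι S q * ω)) := by
        rw [← mul_assoc, ι_mul_ι_swap, neg_mul, mul_assoc]
      simp only [r', map_sub, map_smul, sub_mul, mul_sub, smul_mul_assoc, mul_smul_comm, hxx,
        smul_zero, hsw, smul_add, smul_smul, smul_neg]
      have hc : D * k 0 0 * -(1 - s * t ^ 4) = -D := by
        have h' := hk0 0
        rw [h0] at h'
        linear_combination (-D) * h'
      rw [hc, hD]
      module
    rw [e1, e2]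
    exact (Linked.base.smul _ _ h01).sub
      ((Linked.base.ι_mul _ _ hrow1).ι_mul _ _ hrow0)
  -- replace the two contracted rows by an explicit multiple of `exp (ω + r' ∧ q)`
  have hstep1 := hlink.pairing_sub_mem hpf hpf hself (List.ofFn fun i : Fin n => i.succ.succ)
  have hpf' := hpf.mul r' q
  have hpf2 := isPfaffianElement_weightElement (s • alphaWeight a b) (gammaWeight c d)
    (fun p (i : Fin n) => u i.succ.succ ^ p) M
  -- `ω + r' ∧ q` agrees on the other coordinates with a scaled form in the remaining variables
  have hstep2 := (Linked.base (J := J) (d := fun i : Fin n => pr i.succ.succ)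
    (d' := fun i => LinearMap.proj i)
    (c := fun i : Fin n => (u i.succ.succ ^ 2 - t ^ 2) * k 0 i.succ.succ)).pairing_sub_mem
      hpf' hpf2 (fun i j => by
        have e1 := hform i.succ.succ j.succ.succ
        have e2 := weightForm_proj_sub_mem (c := c) (d := d)
          (u := fun i : Fin n => u i.succ.succ)
          (f := fun i => f i.succ.succ) (fun i => hf _) M (fun i => hJ _) i j
          (hk i.succ.succ j.succ.succ)
        have e3 := sub_mem e1 (J.mul_mem_left (((u i.succ.succ ^ 2 - t ^ 2) * k 0 i.succ.succ) *
          ((u j.succ.succ ^ 2 - t ^ 2) * k 0 j.succ.succ) * s) e2)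
        convert! e3 using 1
        rw [weightForm_smul]
        simp only [pr, r', r, q, LinearMap.coe_proj, Function.eval, smul_eq_mul, map_add,
          map_sub, map_smul]
        have k1 := hk i.succ.succ j.succ.succ
        have k2 := hk0 i.succ.succ
        have k3 := hk0 j.succ.succ
        generalize u i.succ.succ = x at *
        generalize u j.succ.succ = y at *
        generalize f i.succ.succ = fx at *
        generalize f j.succ.succ = fy at *
        generalize k i.succ.succ j.succ.succ = kxy at *
        generalize k 0 i.succ.succ = kx at *
        generalize k 0 j.succ.succ = ky at *
        linear_combination (fx * (1 + c * y) - fy * (1 + c * x)) *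
          (-kxy * k2 - kxy * ((1 - s * t ^ 2 * x ^ 2) * kx) * k3 +
            (1 - s * t ^ 4) * kx * ky * k1)) (List.ofFn fun i : Fin n => i)
  simp only [List.map_ofFn, Function.comp_def, List.prod_ofFn, pairing_smul] at hstep1 hstep2
  have hpair : truncatedPfaffian (alphaWeight a b) (gammaWeight c d) u M =
      pairing (List.ofFn fun i : Fin n => pr i.succ.succ)
        (contractLeft (pr 1) (contractLeft (pr 0) ω)) := by
    rw [truncatedPfaffian, List.ofFn_succ, List.ofFn_succ]
    rfl
  rw [hpair]
  convert! add_mem hstep1 (J.mul_mem_left (D * k 0 0) hstep2) using 1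
  rw [truncatedPfaffian]
  simp only [Finset.prod_const_one]
  ring

end Reduction

/-! ### The cancellation property of the Schur sum -/

section Specialization

variable {R : Type*} [CommRing R]

/-- The specialisation `x₀ = X₀`, `x₁ = -X₀`, `x_i = X_i` for `2 ≤ i < 2 m + 2`, `x_i = 0`
beyond. -/
noncomputable def pairedVars (R : Type*) [CommRing R] (m i : ℕ) : MvPowerSeries ℕ R :=
  if i = 0 then MvPowerSeries.X 0 else if i = 1 then -MvPowerSeries.X 0 else
    if i < 2 * m + 2 then MvPowerSeries.X i else 0

/-- The specialisation `x_i = X_{i + 2}` for `i < 2 m`, `x_i = 0` beyond. -/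
noncomputable def tailVars (R : Type*) [CommRing R] (m i : ℕ) : MvPowerSeries ℕ R :=
  if i < 2 * m then MvPowerSeries.X (i + 2) else 0

theorem constantCoeff_pairedVars (m i : ℕ) :
    MvPowerSeries.constantCoeff (pairedVars R m i) = 0 := by
  unfold pairedVars
  split_ifs <;> simp

theorem constantCoeff_tailVars (m i : ℕ) :
    MvPowerSeries.constantCoeff (tailVars R m i) = 0 := by
  unfold tailVars
  split_ifs <;> simp

theorem pairedVars_eq_zero {m i : ℕ} (hi : 2 * (m + 1) ≤ i) : pairedVars R m i = 0 := by
  rw [pairedVars, if_neg (by omega), if_neg (by omega), if_neg (by omega)]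

theorem tailVars_eq_zero {m i : ℕ} (hi : 2 * m ≤ i) : tailVars R m i = 0 :=
  if_neg (by omega)

theorem pairedVars_add_two (m i : ℕ) : pairedVars R m (i + 2) = tailVars R m i := by
  rw [pairedVars, tailVars, if_neg (by omega), if_neg (by omega)]
  simp

theorem hasSubst_pairedVars (m : ℕ) : MvPowerSeries.HasSubst (pairedVars R m) :=
  hasSubst_of_eventually_zero (constantCoeff_pairedVars m) fun _ => pairedVars_eq_zero

theorem hasSubst_tailVars (m : ℕ) : MvPowerSeries.HasSubst (tailVars R m) :=
  hasSubst_of_eventually_zero (constantCoeff_tailVars m) fun _ => tailVars_eq_zero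

theorem exists_one_sub_mul_eq_one {y : MvPowerSeries ℕ R}
    (hy : MvPowerSeries.constantCoeff y = 0) : ∃ k, (1 - y) * k = 1 := by
  have : IsUnit (1 - y) := by
    rw [MvPowerSeries.isUnit_iff_constantCoeff]
    simp [hy]
  exact this.exists_right_inv

/-- Congruences modulo higher and higher powers of series without constant term become equalities
in the limit. -/
theorem tendsto_zero_of_mem_span_pow [TopologicalSpace R] {N : ℕ} {u : Fin N → MvPowerSeries ℕ R}
    (hu : ∀ i, MvPowerSeries.constantCoeff (u i) = 0) {F : ℕ → MvPowerSeries ℕ R}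
    (hF : ∀ M, F M ∈ Ideal.span (Set.range fun i => u i ^ M)) :
    Filter.Tendsto F Filter.atTop (nhds 0) := by
  rw [MvPowerSeries.WithPiTopology.tendsto_iff_coeff_tendsto]
  intro m
  refine tendsto_const_nhds.congr' ?_
  filter_upwards [Filter.eventually_gt_atTop m.degree] with M hM
  rw [map_zero]
  symm
  have key : ∀ k : ℕ →₀ ℕ, k.degree < M → MvPowerSeries.coeff k (F M) = 0 := by
    refine Submodule.span_induction
      (p := fun x _ => ∀ k : ℕ →₀ ℕ, k.degree < M → MvPowerSeries.coeff k x = 0) ?_ ?_ ?_ ?_ (hF M)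
    · rintro _ ⟨i, rfl⟩ k hk
      refine MvPowerSeries.coeff_of_lt_order (lt_of_lt_of_le (b := (M : ℕ∞)) ?_ ?_)
      · exact_mod_cast hk
      · refine le_trans ?_ (MvPowerSeries.le_order_pow M)
        have h1 : (1 : ℕ∞) ≤ (u i).order := by
          rw [MvPowerSeries.one_le_order_iff_constCoeff_eq_zero]
          exact hu i
        simpa using nsmul_le_nsmul_right h1 M
    · simp
    · intro x y _ _ hx hy k hk
      rw [map_add, hx k hk, hy k hk, add_zero]
    · intro r x _ hx k hk
      classical
      rw [smul_eq_mul, MvPowerSeries.coeff_mul]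
      refine Finset.sum_eq_zero fun p hp => ?_
      rw [hx p.2 (lt_of_le_of_lt ?_ hk), mul_zero]
      rw [← Finset.HasAntidiagonal.mem_antidiagonal.mp hp, map_add]
      exact Nat.le_add_left _ _
  exact key m hM

theorem truncatedPfaffian_smul {S : Type*} [CommRing S] (s : S) (α γ : ℕ → S) {m : ℕ}
    (u : Fin (2 * m) → S) (M : ℕ) :
    truncatedPfaffian (s • α) γ u M = s ^ m * truncatedPfaffian α γ u M :=
  pairing_weightElement_smul s α γ _ M m _

theorem prod_sub_add_two {S : Type*} [CommRing S] {n : ℕ} (u : Fin (n + 2) → S) :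
    (∏ i, ∏ j ∈ Finset.Ioi i, (u i - u j)) =
      (u 0 - u 1) * (∏ i : Fin n, (u 0 - u i.succ.succ)) * (∏ i : Fin n, (u 1 - u i.succ.succ)) *
        ∏ i : Fin n, ∏ j ∈ Finset.Ioi i, (u i.succ.succ - u j.succ.succ) := by
  change (∏ i : Fin (n + 1 + 1), _) = _
  rw [Fin.prod_univ_succ, Fin.prod_univ_succ]
  simp only [Fin.prod_Ioi_succ, Fin.prod_Ioi_zero]
  rw [Fin.prod_univ_succ, Fin.succ_zero_eq_one]
  ring

theorem prod_sub_pairedVars (m : ℕ) :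
    (∏ i : Fin (2 * (m + 1)), ∏ j ∈ Finset.Ioi i, (pairedVars R m i - pairedVars R m j)) =
      2 * MvPowerSeries.X 0 *
        (∏ i : Fin (2 * m), (tailVars R m i ^ 2 - (MvPowerSeries.X 0 : MvPowerSeries ℕ R) ^ 2)) *
        ∏ i : Fin (2 * m), ∏ j ∈ Finset.Ioi i, (tailVars R m i - tailVars R m j) := by
  refine (prod_sub_add_two (n := 2 * m) fun i => pairedVars R m i).trans ?_
  have h (i : Fin (2 * m)) : pairedVars R m (i.succ.succ : Fin (2 * m + 2)) =
      tailVars R m i := pairedVars_add_two m i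
  have h0 : pairedVars R m ((0 : Fin (2 * m + 2)) : ℕ) = MvPowerSeries.X 0 := rfl
  have h1 : pairedVars R m ((1 : Fin (2 * m + 2)) : ℕ) = -MvPowerSeries.X 0 := rfl
  simp only [h, h0, h1]
  have h2 : (∏ i : Fin (2 * m),
      (tailVars R m i ^ 2 - (MvPowerSeries.X 0 : MvPowerSeries ℕ R) ^ 2)) =
      (∏ i : Fin (2 * m), ((MvPowerSeries.X 0 : MvPowerSeries ℕ R) - tailVars R m i)) *
        ∏ i : Fin (2 * m), (-(MvPowerSeries.X 0 : MvPowerSeries ℕ R) - tailVars R m i) := by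
    rw [← Finset.prod_mul_distrib]
    exact Finset.prod_congr rfl fun i _ => by ring
  rw [h2]
  ring

/-- The Schur sum at `t, -t, x` is an explicit factor times the Schur sum at `x`: both are quotients
of a limit of Pfaffians by a Vandermonde determinant. -/
theorem subst_pairedVars_schurSum [IsDomain R] [CharZero R] {a b c d : R}
    (hs : a * b * c * d ≠ 0) (m : ℕ) :
    (1 - MvPowerSeries.C (a * b) * MvPowerSeries.X 0 ^ 2) *
      (1 - MvPowerSeries.C (a * b * c * d) * MvPowerSeries.X 0 ^ 4) *
      (∏ i : Fin (2 * m), (1 - MvPowerSeries.C (a * b * c * d) * MvPowerSeries.X 0 ^ 2 *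
        tailVars R m i ^ 2)) *
      MvPowerSeries.subst (pairedVars R m) (schurSum a b c d) =
    (1 - MvPowerSeries.C (a * c) * MvPowerSeries.X 0 ^ 2) *
      MvPowerSeries.subst (tailVars R m) (schurSum a b c d) := by
  let _ : TopologicalSpace R := ⊥
  have _ : DiscreteTopology R := ⟨rfl⟩
  set t : MvPowerSeries ℕ R := MvPowerSeries.X 0 with ht
  set A : MvPowerSeries ℕ R := MvPowerSeries.C a with hA
  set B : MvPowerSeries ℕ R := MvPowerSeries.C b with hB
  set C : MvPowerSeries ℕ R := MvPowerSeries.C c with hC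
  set D : MvPowerSeries ℕ R := MvPowerSeries.C d with hD
  simp only [map_mul, ← hA, ← hB, ← hC, ← hD]
  have hα : (fun p => MvPowerSeries.C (alphaWeight a b p)) = alphaWeight A B := by
    ext1 p
    simp [alphaWeight, hA, hB]
  have hγ : (fun p => MvPowerSeries.C (gammaWeight c d p)) = gammaWeight C D := by
    ext1 p
    simp [gammaWeight, hC, hD]
  have l1 := tendsto_truncatedPfaffian a b c d (m + 1) (constantCoeff_pairedVars m)
    fun _ => pairedVars_eq_zero (R := R)
  have l2 := tendsto_truncatedPfaffian a b c d m (constantCoeff_tailVars m)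
    fun _ => tailVars_eq_zero (R := R)
  rw [hα, hγ, prod_sub_pairedVars, ← ht] at l1
  rw [hα, hγ] at l2
  let u : Fin (2 * m + 2) → MvPowerSeries ℕ R := fun i => pairedVars R m i
  have hu0 (i) : MvPowerSeries.constantCoeff (u i) = 0 := constantCoeff_pairedVars m i
  have hux (i : Fin (2 * m)) : u i.succ.succ = tailVars R m i := pairedVars_add_two m i
  have hf (i) : ∃ f, (1 - A * B * u i ^ 2) * f = u i + A * u i ^ 2 := by
    obtain ⟨k, hk⟩ := exists_one_sub_mul_eq_one (y := A * B * u i ^ 2) (by simp [hu0])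
    exact ⟨k * (u i + A * u i ^ 2), by linear_combination (u i + A * u i ^ 2) * hk⟩
  choose f hf using hf
  have hk (i j) : ∃ k, (1 - A * B * C * D * u i ^ 2 * u j ^ 2) * k = 1 :=
    exists_one_sub_mul_eq_one (by simp [hu0])
  choose k hk using hk
  have hmem (M : ℕ) := truncatedPfaffian_sub_mem (t := t) (u := u) (c := C) (d := D) rfl rfl hf hk M
    (J := Ideal.span (Set.range fun i => u i ^ M)) fun i => Ideal.subset_span ⟨i, rfl⟩
  have l3 := tendsto_zero_of_mem_span_pow hu0 hmem
  simp only [truncatedPfaffian_smul, hux] at l3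
  have l4 := (l1.sub (l2.const_mul ((f 0 * (1 - C * t) - f 1 * (1 + C * t)) * k 0 0 *
    (∏ i : Fin (2 * m), (tailVars R m i ^ 2 - t ^ 2) * k 0 i.succ.succ) *
      (A * B * C * D) ^ m)))
  have l5 := tendsto_nhds_unique (l4.congr fun M => by rw [mul_assoc]; rfl) l3
  have hf0 := hf 0
  have hf1 := hf 1
  have hk0 := hk 0 0
  have hu_zero : u 0 = t := rfl
  have hu_one : u 1 = -t := rfl
  rw [hu_zero] at hf0 hk0
  rw [hu_one] at hf1
  have hprod : (∏ i : Fin (2 * m), (1 - A * B * C * D * t ^ 2 * tailVars R m i ^ 2)) *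
      (∏ i : Fin (2 * m), (tailVars R m i ^ 2 - t ^ 2) * k 0 i.succ.succ) =
      ∏ i : Fin (2 * m), (tailVars R m i ^ 2 - t ^ 2) := by
    rw [← Finset.prod_mul_distrib]
    refine Finset.prod_congr rfl fun i _ => ?_
    have h := hk 0 i.succ.succ
    rw [hux, hu_zero] at h
    linear_combination (tailVars R m i ^ 2 - t ^ 2) * h
  have hpow : MvPowerSeries.C ((a * b * c * d) ^ (∑ i ∈ Finset.range (m + 1), i)) =
      (A * B * C * D) ^ m *
        MvPowerSeries.C (σ := ℕ) ((a * b * c * d) ^ (∑ i ∈ Finset.range m, i)) := by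
    rw [Finset.sum_range_succ, pow_add, map_mul, mul_comm, map_pow]
    simp only [map_mul, hA, hB, hC, hD]
  rw [hpow] at l5
  set V := ∏ i : Fin (2 * m), ∏ j ∈ Finset.Ioi i, (tailVars R m i - tailVars R m j) with hV
  set W := ∏ i : Fin (2 * m), (tailVars R m i ^ 2 - t ^ 2) with hW
  set E : MvPowerSeries ℕ R := MvPowerSeries.C ((a * b * c * d) ^ (∑ i ∈ Finset.range m, i))
  have hX : ∀ {i j : ℕ}, (MvPowerSeries.X i : MvPowerSeries ℕ R) = MvPowerSeries.X j → i = j := by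
    intro i j h
    exact MvPowerSeries.X_inj.mp h
  have hV0 : V ≠ 0 := by
    refine Finset.prod_ne_zero_iff.mpr fun i _ => Finset.prod_ne_zero_iff.mpr fun j hj => ?_
    rw [sub_ne_zero, tailVars, tailVars, if_pos i.isLt, if_pos j.isLt]
    intro h
    have h1 := hX h
    have h2 : (i : ℕ) < j := Fin.lt_def.mp (Finset.mem_Ioi.mp hj)
    omega
  have hW0 : W ≠ 0 := by
    refine Finset.prod_ne_zero_iff.mpr fun i _ => ?_
    rw [tailVars, if_pos i.isLt, ht, sub_ne_zero, MvPowerSeries.X_pow_eq, MvPowerSeries.X_pow_eq]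
    intro h
    have h1 := congrArg (MvPowerSeries.coeff (Finsupp.single 0 2)) h
    rw [MvPowerSeries.coeff_monomial_same, MvPowerSeries.coeff_monomial_ne] at h1
    · exact zero_ne_one h1
    · intro h2
      have := DFunLike.congr_fun h2 0
      simp at this
  have hE0 : E ≠ 0 := by
    rw [Ne, map_eq_zero_iff _ MvPowerSeries.C_injective]
    exact pow_ne_zero _ hs
  have hs0 : (A * B * C * D) ^ m ≠ 0 := by
    refine pow_ne_zero _ ?_
    rw [hA, hB, hC, hD, ← map_mul, ← map_mul, ← map_mul, Ne,
      map_eq_zero_iff _ MvPowerSeries.C_injective]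
    exact hs
  have ht0 : t ≠ 0 := by
    intro h
    have h1 := congrArg (MvPowerSeries.coeff (Finsupp.single 0 1)) h
    rw [ht, MvPowerSeries.coeff_index_single_self_X] at h1
    exact one_ne_zero h1
  have h20 : (2 : MvPowerSeries ℕ R) ≠ 0 := by
    have : (2 : MvPowerSeries ℕ R) = MvPowerSeries.C 2 := (map_ofNat _ 2).symm
    rw [this, Ne, map_eq_zero_iff _ MvPowerSeries.C_injective]
    exact two_ne_zero
  -- cancel the Vandermonde determinant of `t, -t, x` and the powers of `a b c d`
  refine mul_left_cancel₀ (mul_ne_zero (mul_ne_zero (mul_ne_zero (mul_ne_zero (mul_ne_zero hE0 hs0)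
    h20) ht0) hW0) hV0) ?_
  have hD' : (1 - A * B * t ^ 2) * (f 0 * (1 - C * t) - f 1 * (1 + C * t)) =
      2 * t * (1 - A * C * t ^ 2) := by
    linear_combination (1 - C * t) * hf0 - (1 + C * t) * hf1
  set Z := MvPowerSeries.subst (pairedVars R m) (schurSum a b c d)
  set Z' := MvPowerSeries.subst (tailVars R m) (schurSum a b c d)
  set G := f 0 * (1 - C * t) - f 1 * (1 + C * t)
  set Q := ∏ i : Fin (2 * m), (tailVars R m i ^ 2 - t ^ 2) * k 0 i.succ.succ
  set P := ∏ i : Fin (2 * m), (1 - A * B * C * D * t ^ 2 * tailVars R m i ^ 2)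
  set s := A * B * C * D
  have hk1 : (1 - s * t ^ 4) * k 0 0 = 1 := by linear_combination hk0
  calc E * s ^ m * 2 * t * W * V * ((1 - A * B * t ^ 2) * (1 - s * t ^ 4) * P * Z)
      = (1 - A * B * t ^ 2) * (1 - s * t ^ 4) * P * (G * k 0 0 * Q * s ^ m * (E * V * Z')) := by
        linear_combination ((1 - A * B * t ^ 2) * (1 - s * t ^ 4) * P) * l5
    _ = E * s ^ m * V * Z' * (((1 - A * B * t ^ 2) * G) * ((1 - s * t ^ 4) * k 0 0) * (P * Q)) := by
        ring
    _ = _ := by rw [hD', hk1, hprod]; ring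

end Specialization

/-! ### Power sums and symmetry -/

section PowerSums

variable {R : Type*} [CommRing R]

theorem hasSum_powerSum [TopologicalSpace R] {r : ℕ} (hr : r ≠ 0) :
    HasSum (fun i : ℕ => (MvPowerSeries.X i : MvPowerSeries ℕ R) ^ r) (powerSum R r) := by
  classical
  refine hasSum_formalSum _ fun m => ?_
  refine (m.support.finite_toSet).subset fun i hi => ?_
  simp only [MvPowerSeries.coeff_X_pow, Set.mem_ofPred_eq, ne_eq, ite_eq_right_iff,
    Classical.not_imp] at hi
  simp [hi.1, hr]

theorem subst_powerSum {σ : Type*} {u : ℕ → MvPowerSeries σ R} {N r : ℕ}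
    (hu : MvPowerSeries.HasSubst u) (hN : ∀ i, N ≤ i → u i = 0) (hr : r ≠ 0) :
    MvPowerSeries.subst u (powerSum R r) = ∑ i ∈ Finset.range N, u i ^ r := by
  let _ : TopologicalSpace R := ⊥
  have _ : DiscreteTopology R := ⟨rfl⟩
  have h := (hasSum_powerSum (R := R) hr).subst_mvPowerSeries hu
  simp only [MvPowerSeries.subst_pow hu, MvPowerSeries.subst_X hu] at h
  refine h.unique (hasSum_sum_of_ne_finset_zero fun i hi => ?_)
  rw [hN i (by simpa using hi), zero_pow hr]

theorem degree_eq_of_coeff_powerSum_ne_zero {r : ℕ} (hr : r ≠ 0) {m : ℕ →₀ ℕ}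
    (h : MvPowerSeries.coeff m (powerSum R r) ≠ 0) : m.degree = r := by
  rw [coeff_powerSum R hr] at h
  split_ifs at h with h1
  · obtain ⟨i, rfl⟩ := h1
    simp
  · exact absurd rfl h

theorem degree_eq_of_coeff_powerSum_sq_ne_zero {r : ℕ} (hr : r ≠ 0) {m : ℕ →₀ ℕ}
    (h : MvPowerSeries.coeff m (powerSum R r ^ 2) ≠ 0) : m.degree = 2 * r := by
  classical
  rw [sq, MvPowerSeries.coeff_mul] at h
  obtain ⟨p, hp, hne⟩ := Finset.exists_ne_zero_of_sum_ne_zero h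
  rw [← Finset.HasAntidiagonal.mem_antidiagonal.mp hp, map_add,
    degree_eq_of_coeff_powerSum_ne_zero hr (left_ne_zero_of_mul hne),
    degree_eq_of_coeff_powerSum_ne_zero hr (right_ne_zero_of_mul hne), two_mul]

theorem IsSymmSeries.sub {f g : MvPowerSeries ℕ R} (hf : IsSymmSeries f) (hg : IsSymmSeries g) :
    IsSymmSeries (f - g) := fun i j => by
  rw [MvPowerSeries.subst_sub (hasSubst_X_comp _), hf i j, hg i j]

theorem IsSymmSeries.smul {f : MvPowerSeries ℕ R} (hf : IsSymmSeries f) (r : R) :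
    IsSymmSeries (r • f) := fun i j => by
  rw [MvPowerSeries.subst_smul (hasSubst_X_comp _), hf i j]

theorem IsSymmSeries.pow {f : MvPowerSeries ℕ R} (hf : IsSymmSeries f) (n : ℕ) :
    IsSymmSeries (f ^ n) := fun i j => by
  rw [MvPowerSeries.subst_pow (hasSubst_X_comp _), hf i j]

theorem isSymmSeries_formalSum {ι : Type*} {f : ι → MvPowerSeries ℕ R}
    (hf : ∀ i, IsSymmSeries (f i)) : IsSymmSeries (formalSum f) :=
  isSymmSeries_of_coeff fun i j m =>
    finsum_congr fun k => (hf k).coeff_mapDomain i j m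

theorem isSymmSeries_powerSum {r : ℕ} (hr : r ≠ 0) : IsSymmSeries (powerSum R r) := by
  refine isSymmSeries_of_coeff fun i j m => ?_
  rw [coeff_powerSum R hr, coeff_powerSum R hr]
  congr 1
  refine propext ⟨fun ⟨k, hk⟩ => ⟨Equiv.swap i j k, ?_⟩, fun ⟨k, hk⟩ => ⟨Equiv.swap i j k, ?_⟩⟩
  · rw [← Finsupp.mapDomain_single, ← hk, ← Finsupp.mapDomain_comp, ← Equiv.coe_trans]
    simp
  · rw [hk, Finsupp.mapDomain_single]

theorem isSymmSeries_schurSum (a b c d : R) : IsSymmSeries (schurSum a b c d) :=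
  isSymmSeries_formalSum fun lam => (isSymmSeries_schur lam).smul _

theorem IsSymmSeries.logSeries [Algebra ℚ R] {f : MvPowerSeries ℕ R} (hf : IsSymmSeries f)
    (hf1 : MvPowerSeries.constantCoeff f = 1) : IsSymmSeries (logSeries f) := fun i j => by
  rw [subst_logSeries (hasSubst_X_comp _) hf1, hf i j]

theorem constantCoeff_schurSum (a b c d : R) :
    MvPowerSeries.constantCoeff (schurSum a b c d) = 1 := by
  rw [← MvPowerSeries.coeff_zero_eq_constantCoeff_apply]
  change ∑ᶠ lam, MvPowerSeries.coeff 0 (omegaWeight a b c d lam • schur R lam) = 1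
  have hbot : (⊥ : YoungDiagram).colLen 0 = 0 := by
    rw [YoungDiagram.colLen_eq_card]
    simp [YoungDiagram.col]
  have hone : schurPoly 0 ⊥ = 1 := by
    have h := alternant_eq_mul_schurPoly 0 ⊥
    simp only [alternant, Matrix.det_isEmpty, one_mul] at h
    exact h.symm
  rw [finsum_eq_single _ ⊥]
  · rw [MvPowerSeries.coeff_smul, coeff_schur R (n := 0) hbot.le (by simp), hone]
    simp [omegaWeight, hbot, MvPolynomial.coeff_one, Subsingleton.elim _ (0 : Fin 0 →₀ ℕ)]
  · intro lam hlam
    by_contra h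
    have h1 := degree_eq_of_coeff_schur_ne_zero R (lam := lam) (m := 0) fun h0 => h (by
      rw [MvPowerSeries.coeff_smul, h0, mul_zero])
    refine hlam (YoungDiagram.ext ?_)
    simpa using h1.symm

end PowerSums

/-! ### The corrected logarithm -/

section Correction

variable {R : Type*} [CommRing R] [Algebra ℚ R]

/-- The correction `∑ aⁿ (bⁿ - cⁿ) p_{2n} / 2n`. -/
noncomputable def linearCorrection (a b c : R) : MvPowerSeries ℕ R :=
  formalSum fun n : ℕ+ => ((1 / (2 * (n : ℚ))) • (a ^ (n : ℕ) * (b ^ (n : ℕ) - c ^ (n : ℕ)))) •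
    powerSum R (2 * n)

/-- The correction `∑ (a b c d)ⁿ p_{2n}² / 4n`. -/
noncomputable def quadraticCorrection (a b c d : R) : MvPowerSeries ℕ R :=
  formalSum fun n : ℕ+ =>
    ((1 / (4 * (n : ℚ))) • (a ^ (n : ℕ) * b ^ (n : ℕ) * c ^ (n : ℕ) * d ^ (n : ℕ))) •
      powerSum R (2 * n) ^ 2

theorem hasSum_linearCorrection [TopologicalSpace R] (a b c : R) :
    HasSum (fun n : ℕ+ => ((1 / (2 * (n : ℚ))) • (a ^ (n : ℕ) * (b ^ (n : ℕ) - c ^ (n : ℕ)))) •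
      powerSum R (2 * n)) (linearCorrection a b c) := by
  refine hasSum_formalSum _ fun m =>
    ((Set.finite_le_nat m.degree).preimage PNat.coe_injective.injOn).subset fun n hn => ?_
  have h := degree_eq_of_coeff_powerSum_ne_zero (R := R) (r := 2 * n) (m := m)
    (by have := n.pos; omega) fun h0 => hn (by rw [MvPowerSeries.coeff_smul, h0, mul_zero])
  change (n : ℕ) ≤ m.degree
  omega

theorem hasSum_quadraticCorrection [TopologicalSpace R] (a b c d : R) :
    HasSum (fun n : ℕ+ =>
      ((1 / (4 * (n : ℚ))) • (a ^ (n : ℕ) * b ^ (n : ℕ) * c ^ (n : ℕ) * d ^ (n : ℕ))) •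
      powerSum R (2 * n) ^ 2) (quadraticCorrection a b c d) := by
  refine hasSum_formalSum _ fun m =>
    ((Set.finite_le_nat m.degree).preimage PNat.coe_injective.injOn).subset fun n hn => ?_
  have h := degree_eq_of_coeff_powerSum_sq_ne_zero (R := R) (r := 2 * n) (m := m)
    (by have := n.pos; omega) fun h0 => hn (by rw [MvPowerSeries.coeff_smul, h0, mul_zero])
  change (n : ℕ) ≤ m.degree
  omega

theorem isSymmSeries_correctedLog (a b c d : R) :
    IsSymmSeries (logSeries (schurSum a b c d) - linearCorrection a b c -
      quadraticCorrection a b c d) := by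
  refine (((isSymmSeries_schurSum a b c d).logSeries (constantCoeff_schurSum a b c d)).sub
    (isSymmSeries_formalSum fun n => IsSymmSeries.smul ?_ _)).sub
    (isSymmSeries_formalSum fun n => IsSymmSeries.smul (IsSymmSeries.pow ?_ _) _) <;>
  exact isSymmSeries_powerSum (by have := n.pos; omega)

theorem subst_pairedVars_powerSum {R : Type*} [CommRing R] (m : ℕ) {r : ℕ} (hr : r ≠ 0) :
    MvPowerSeries.subst (pairedVars R m) (powerSum R r) =
      MvPowerSeries.subst (tailVars R m) (powerSum R r) +
        (MvPowerSeries.X 0 ^ r + (-MvPowerSeries.X 0) ^ r) := by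
  rw [subst_powerSum (hasSubst_pairedVars m) (fun _ => pairedVars_eq_zero) hr,
    subst_powerSum (hasSubst_tailVars m) (fun _ => tailVars_eq_zero) hr]
  change ∑ i ∈ Finset.range (2 * m + 1 + 1), _ = _
  rw [Finset.sum_range_succ', Finset.sum_range_succ']
  simp only [add_assoc, Nat.reduceAdd, pairedVars_add_two]
  simp only [pairedVars]
  simp [add_comm]

theorem subst_pairedVars_linearCorrection (a b c : R) (m : ℕ) :
    MvPowerSeries.subst (pairedVars R m) (linearCorrection a b c) =
      MvPowerSeries.subst (tailVars R m) (linearCorrection a b c) +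
        (logSeries (1 - MvPowerSeries.C (a * c) * MvPowerSeries.X 0 ^ 2) -
          logSeries (1 - MvPowerSeries.C (a * b) * MvPowerSeries.X 0 ^ 2)) := by
  let _ : TopologicalSpace R := ⊥
  have _ : DiscreteTopology R := ⟨rfl⟩
  have h1 := (hasSum_linearCorrection a b c).subst_mvPowerSeries (hasSubst_pairedVars m)
  have h2 := (hasSum_linearCorrection a b c).subst_mvPowerSeries (hasSubst_tailVars m)
  have h3 := hasSum_logSeries_one_sub (R := R)
    (y := MvPowerSeries.C (a * c) * MvPowerSeries.X 0 ^ 2) (by simp)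
  have h4 := hasSum_logSeries_one_sub (R := R)
    (y := MvPowerSeries.C (a * b) * MvPowerSeries.X 0 ^ 2) (by simp)
  refine h1.unique ?_
  have h5 := h2.add (h4.sub h3)
  rw [neg_sub_neg] at h5
  refine (congrArg (HasSum · _) (funext fun n => ?_)).mp h5
  have hn : 2 * (n : ℕ) ≠ 0 := by have := n.pos; omega
  rw [MvPowerSeries.subst_smul (hasSubst_pairedVars m),
    MvPowerSeries.subst_smul (hasSubst_tailVars m), subst_pairedVars_powerSum m hn, smul_add,
    (even_two_mul (n : ℕ)).neg_pow, ← two_mul]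
  congr 1
  have hq : 1 / (n : ℚ) = 1 / (2 * (n : ℚ)) * 2 := by
    have := n.ne_zero
    field_simp
  rw [← smul_sub, smul_assoc, hq, mul_smul, ofNat_smul_eq_nsmul, two_nsmul, two_mul,
    MvPowerSeries.smul_eq_C_mul]
  congr 1
  simp only [map_mul, map_sub, map_pow]
  ring

theorem subst_pairedVars_quadraticCorrection (a b c d : R) (m : ℕ) :
    MvPowerSeries.subst (pairedVars R m) (quadraticCorrection a b c d) =
      MvPowerSeries.subst (tailVars R m) (quadraticCorrection a b c d) -
        (logSeries (1 - MvPowerSeries.C (a * b * c * d) * MvPowerSeries.X 0 ^ 4) +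
          ∑ i : Fin (2 * m), logSeries (1 - MvPowerSeries.C (a * b * c * d) *
            MvPowerSeries.X 0 ^ 2 * tailVars R m i ^ 2)) := by
  let _ : TopologicalSpace R := ⊥
  have _ : DiscreteTopology R := ⟨rfl⟩
  have h1 := (hasSum_quadraticCorrection a b c d).subst_mvPowerSeries (hasSubst_pairedVars m)
  have h2 := (hasSum_quadraticCorrection a b c d).subst_mvPowerSeries (hasSubst_tailVars m)
  have h3 := hasSum_logSeries_one_sub (R := R)
    (y := MvPowerSeries.C (a * b * c * d) * MvPowerSeries.X 0 ^ 4) (by simp)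
  have h4 := hasSum_sum (s := Finset.univ) fun (i : Fin (2 * m)) _ =>
    hasSum_logSeries_one_sub (R := R)
    (y := MvPowerSeries.C (a * b * c * d) * MvPowerSeries.X 0 ^ 2 * tailVars R m i ^ 2) (by simp)
  refine h1.unique ?_
  have h5 := h2.add (h3.add h4)
  rw [Finset.sum_neg_distrib, ← neg_add, ← sub_eq_add_neg] at h5
  refine (congrArg (HasSum · _) (funext fun n => ?_)).mp h5
  have hn : 2 * (n : ℕ) ≠ 0 := by have := n.pos; omega
  rw [MvPowerSeries.subst_smul (hasSubst_pairedVars m),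
    MvPowerSeries.subst_smul (hasSubst_tailVars m), MvPowerSeries.subst_pow (hasSubst_pairedVars m),
    MvPowerSeries.subst_pow (hasSubst_tailVars m), subst_pairedVars_powerSum m hn,
    (even_two_mul (n : ℕ)).neg_pow, ← two_mul,
    subst_powerSum (hasSubst_tailVars m) (fun _ => tailVars_eq_zero) hn,
    ← Fin.sum_univ_eq_sum_range (fun i => tailVars R m i ^ (2 * (n : ℕ)))]
  have hq : 1 / (n : ℚ) = 1 / (4 * (n : ℚ)) * 4 := by
    have := n.ne_zero
    field_simp
  rw [smul_assoc, smul_assoc, hq, ← Finset.smul_sum, ← smul_add,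
    mul_smul (1 / (4 * (n : ℚ))) 4, ofNat_smul_eq_nsmul, ← smul_add,
    MvPowerSeries.smul_eq_C_mul, MvPowerSeries.smul_eq_C_mul]
  congr 1
  have hsum : ∑ i : Fin (2 * m), (MvPowerSeries.C (a * b * c * d) * MvPowerSeries.X 0 ^ 2 *
      tailVars R m i ^ 2) ^ (n : ℕ) = (MvPowerSeries.C (a * b * c * d) * MvPowerSeries.X 0 ^ 2) ^
        (n : ℕ) * ∑ i : Fin (2 * m), tailVars R m i ^ (2 * (n : ℕ)) := by
    rw [Finset.mul_sum]
    exact Finset.sum_congr rfl fun i _ => by rw [mul_pow, ← pow_mul]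
  rw [hsum]
  simp only [map_mul, map_pow, nsmul_eq_mul]
  push_cast
  ring

/-- The corrected logarithm of the Schur sum does not change when a pair of variables `t, -t` is
adjoined. -/
theorem subst_pairedVars_correctedLog [IsDomain R] [CharZero R] {a b c d : R}
    (hs : a * b * c * d ≠ 0) (m : ℕ) :
    MvPowerSeries.subst (pairedVars R m) (logSeries (schurSum a b c d) - linearCorrection a b c -
      quadraticCorrection a b c d) =
    MvPowerSeries.subst (tailVars R m) (logSeries (schurSum a b c d) - linearCorrection a b c -
      quadraticCorrection a b c d) := by
  have h := congrArg logSeries (subst_pairedVars_schurSum hs m)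
  have hz := constantCoeff_schurSum a b c d
  have hz1 := (constantCoeff_subst_of_zero (hasSubst_pairedVars (R := R) m)
    (constantCoeff_pairedVars m) (schurSum a b c d)).trans hz
  have hz2 := (constantCoeff_subst_of_zero (hasSubst_tailVars (R := R) m)
    (constantCoeff_tailVars m) (schurSum a b c d)).trans hz
  rw [logSeries_mul (by simp) hz1, logSeries_mul (by simp) hz2, logSeries_mul (by simp) (by simp),
    logSeries_mul (by simp) (by simp), logSeries_prod _ _ (by simp)] at h
  simp only [MvPowerSeries.subst_sub (hasSubst_pairedVars m),
    MvPowerSeries.subst_sub (hasSubst_tailVars m), subst_logSeries (hasSubst_pairedVars m) hz,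
    subst_logSeries (hasSubst_tailVars m) hz, subst_pairedVars_linearCorrection,
    subst_pairedVars_quadraticCorrection]
  linear_combination h

end Correction

/-! ### Symmetric series with the cancellation property -/

section Vanishing

variable {R : Type*} [CommRing R]

theorem IsSymmSeries.coeff_mapDomain_perm {f : MvPowerSeries ℕ R} (h : IsSymmSeries f)
    (e : Equiv.Perm ℕ) (m : ℕ →₀ ℕ) :
    MvPowerSeries.coeff (m.mapDomain e) f = MvPowerSeries.coeff m f := by
  -- on a finite set of variables, `e` agrees with a product of transpositions
  have key (s : Finset ℕ) : ∃ e' : Equiv.Perm ℕ, (∀ i ∈ s, e' i = e i) ∧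
      ∀ m : ℕ →₀ ℕ, MvPowerSeries.coeff (m.mapDomain e') f = MvPowerSeries.coeff m f := by
    induction s using Finset.induction_on with
    | empty => exact ⟨1, by simp, fun m => by simp [Equiv.Perm.coe_one]⟩
    | insert a s ha ih =>
      obtain ⟨e', h1, h2⟩ := ih
      refine ⟨e'.trans (Equiv.swap (e' a) (e a)), fun i hi => ?_, fun m => ?_⟩
      · rcases Finset.mem_insert.mp hi with rfl | hi
        · simp
        · have hne : i ≠ a := fun h => ha (h ▸ hi)
          rw [Equiv.trans_apply, Equiv.swap_apply_of_ne_of_ne (e'.injective.ne hne), h1 i hi]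
          rw [h1 i hi]
          exact e.injective.ne hne
      · rw [Equiv.coe_trans, Finsupp.mapDomain_comp, h.coeff_mapDomain, h2]
  obtain ⟨e', h1, h2⟩ := key m.support
  rw [← h2 m, Finsupp.mapDomain_congr h1]

/-- The coefficients of a symmetric series depend only on the multiplicities of the nonzero
exponents. -/
theorem IsSymmSeries.coeff_eq_of_card_fiber_eq {f : MvPowerSeries ℕ R} (h : IsSymmSeries f)
    {m m' : ℕ →₀ ℕ}
    (hm : ∀ v, v ≠ 0 → (m.support.filter (m · = v)).card = (m'.support.filter (m' · = v)).card) :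
    MvPowerSeries.coeff m f = MvPowerSeries.coeff m' f := by
  have hfib (v : ℕ) : Nonempty ({i // m i = v} ≃ {i // m' i = v}) := by
    by_cases hv : v = 0
    · subst hv
      have hinf (k : ℕ →₀ ℕ) : Infinite {i // k i = 0} := by
        have : Set.Infinite {i | k i = 0} := by
          refine (k.support.finite_toSet.infinite_compl).mono fun i hi => ?_
          simpa using hi
        exact this.to_subtype
      have := hinf m
      have := hinf m'
      exact nonempty_equiv_of_countable
    · have hfin (k : ℕ →₀ ℕ) : Nonempty ({i // k i = v} ≃ (k.support.filter (k · = v))) :=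
        ⟨Equiv.subtypeEquivRight fun i => by
          rw [Finset.mem_filter, Finsupp.mem_support_iff]
          exact ⟨fun h => ⟨by rwa [h], h⟩, fun h => h.2⟩⟩
      obtain ⟨e1⟩ := hfin m
      obtain ⟨e2⟩ := hfin m'
      exact ⟨e1.trans ((Finset.equivOfCardEq (hm v hv)).trans e2.symm)⟩
  -- all fibres are equivalent, so a permutation of the variables takes `m` to `m'`
  let e : Equiv.Perm ℕ := Equiv.ofFiberEquiv (f := m) (g := m') fun v => (hfib v).some
  have he : m.mapDomain e = m' := by
    ext i
    rw [Finsupp.mapDomain_equiv_apply, ← Equiv.ofFiberEquiv_map (f := m) (g := m')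
      (fun v => (hfib v).some) (e.symm i)]
    exact congrArg m' (e.apply_symm_apply i)
  rw [← he, h.coeff_mapDomain_perm]

theorem prod_pow_pairedVars {N : ℕ} {k : ℕ →₀ ℕ} (hk : ∀ i, 2 * N + 2 ≤ i → k i = 0) :
    (k.prod fun i n => pairedVars R N i ^ n) =
      (-1) ^ k 1 * MvPowerSeries.monomial (k.mapDomain fun i => if i = 1 then 0 else i) 1 := by
  classical
  have h1 (i : ℕ) (hi : i ∈ k.support) : pairedVars R N i ^ k i =
      (if i = 1 then (-1) ^ k 1 else 1) *
        (MvPowerSeries.X (if i = 1 then 0 else i) : MvPowerSeries ℕ R) ^ k i := by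
    have hi' : i < 2 * N + 2 := by
      by_contra h
      exact Finsupp.mem_support_iff.mp hi (hk i (by omega))
    unfold pairedVars
    rcases eq_or_ne i 0 with rfl | h0
    · simp
    rcases eq_or_ne i 1 with rfl | h1
    · rw [if_neg one_ne_zero, if_pos rfl, if_pos rfl, if_pos rfl, neg_pow]
    · simp [h0, h1, hi']
  have h2 : (∏ i ∈ k.support, if i = 1 then (-1 : MvPowerSeries ℕ R) ^ k 1 else 1) =
      (-1) ^ k 1 := by
    rw [Finset.prod_ite_eq']
    split_ifs with h
    · rfl
    · rw [Finsupp.notMem_support_iff.mp h, pow_zero]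
  rw [Finsupp.prod, Finset.prod_congr rfl h1, Finset.prod_mul_distrib, h2,
    MvPowerSeries.monomial_one_eq, Finsupp.prod_mapDomain_index]
  · rfl
  · simp
  · simp [pow_add]

theorem coeff_subst_tailVars {N : ℕ} (f : MvPowerSeries ℕ R) {m : ℕ →₀ ℕ} (hm : m 0 ≠ 0) :
    MvPowerSeries.coeff m (MvPowerSeries.subst (tailVars R N) f) = 0 := by
  classical
  rw [MvPowerSeries.coeff_subst (hasSubst_tailVars N)]
  refine finsum_eq_zero_of_forall_eq_zero fun k => ?_
  by_cases hk : ∀ i ∈ k.support, i < 2 * N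
  · have h1 : (k.prod fun i n => tailVars R N i ^ n) =
        MvPowerSeries.monomial (k.mapDomain (· + 2)) 1 := by
      rw [MvPowerSeries.monomial_one_eq, Finsupp.prod_mapDomain_index_inj (add_left_injective 2)]
      exact Finset.prod_congr rfl fun i hi => by
        change tailVars R N i ^ k i = _
        rw [tailVars, if_pos (hk i hi)]
    rw [h1, MvPowerSeries.coeff_monomial, if_neg, smul_zero]
    rintro rfl
    exact hm (Finsupp.mapDomain_of_notMem_range _ _ (by simp))
  · push Not at hk
    obtain ⟨i, hi, hiN⟩ := hk
    have : (k.prod fun i n => tailVars R N i ^ n) = 0 :=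
      Finset.prod_eq_zero hi (by
        change tailVars R N i ^ k i = 0
        rw [tailVars_eq_zero hiN, zero_pow (Finsupp.mem_support_iff.mp hi)])
    rw [this, map_zero, smul_zero]

/-- Identifying the variables `0` and `1` adds up their exponents. -/
theorem mapDomain_merge (k : ℕ →₀ ℕ) :
    (k.mapDomain fun i => if i = 1 then 0 else i) =
      Finsupp.single 0 (k 0 + k 1) + (k.erase 0).erase 1 := by
  have hk : k = Finsupp.single 0 (k 0) + Finsupp.single 1 (k 1) + (k.erase 0).erase 1 := by
    ext i
    rcases eq_or_ne i 0 with rfl | h0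
    · simp
    rcases eq_or_ne i 1 with rfl | h1
    · simp
    simp [h0, h1]
  conv_lhs => rw [hk]
  rw [Finsupp.mapDomain_add, Finsupp.mapDomain_add, Finsupp.mapDomain_single,
    Finsupp.mapDomain_single, Finsupp.single_add]
  congr 1
  conv_rhs => rw [← Finsupp.mapDomain_id (v := (k.erase 0).erase 1)]
  refine Finsupp.mapDomain_congr fun i hi => ?_
  have : i ≠ 1 := by
    rintro rfl
    simp at hi
  simp [this]

/-- The coefficients of a series at `t, -t, x` are alternating sums. -/
theorem coeff_subst_pairedVars {N : ℕ} (f : MvPowerSeries ℕ R) {m : ℕ →₀ ℕ} (hm1 : m 1 = 0)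
    (hm : ∀ i, 2 * N + 2 ≤ i → m i = 0) :
    MvPowerSeries.coeff m (MvPowerSeries.subst (pairedVars R N) f) =
      ∑ j ∈ Finset.range (m 0 + 1), (-1) ^ j * MvPowerSeries.coeff
        (Finsupp.single 0 (m 0 - j) + Finsupp.single 1 j + m.erase 0) f := by
  classical
  set κ : ℕ → ℕ →₀ ℕ := fun j => Finsupp.single 0 (m 0 - j) + Finsupp.single 1 j + m.erase 0 with hκ
  have hκ0 (j) : κ j 0 = m 0 - j := by simp [hκ]
  have hκ1 (j) : κ j 1 = j := by simp [hκ, hm1]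
  have hκ2 (j i) (h0 : i ≠ 0) (h1 : i ≠ 1) : κ j i = m i := by
    simp [hκ, h0, h1]
  have hinj : Function.Injective κ := fun i j h => by rw [← hκ1 i, h, hκ1]
  have hterm (k : ℕ →₀ ℕ) : MvPowerSeries.coeff m (k.prod fun i n => pairedVars R N i ^ n) =
      if k ∈ (Finset.range (m 0 + 1)).image κ then (-1) ^ k 1 else 0 := by
    by_cases hk : ∀ i, 2 * N + 2 ≤ i → k i = 0
    · have hC : ((-1) ^ k 1 : MvPowerSeries ℕ R) = MvPowerSeries.C ((-1) ^ k 1) := by simp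
      rw [prod_pow_pairedVars hk, hC, MvPowerSeries.coeff_C_mul, MvPowerSeries.coeff_monomial,
        mul_ite, mul_one, mul_zero]
      congr 1
      rw [mapDomain_merge, Finset.mem_image, eq_iff_iff]
      constructor
      · intro h
        have h0 : m 0 = k 0 + k 1 := by rw [h]; simp
        refine ⟨k 1, by rw [Finset.mem_range]; omega, ?_⟩
        ext i
        rcases eq_or_ne i 0 with rfl | hi0
        · rw [hκ0]; omega
        rcases eq_or_ne i 1 with rfl | hi1
        · rw [hκ1]
        rw [hκ2 _ _ hi0 hi1, h]
        simp [hi0, hi1]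
      · rintro ⟨j, hj, rfl⟩
        have := Finset.mem_range.mp hj
        ext i
        rcases eq_or_ne i 0 with rfl | hi0
        · simp only [Finsupp.add_apply, Finsupp.single_eq_same, hκ0, hκ1]
          simp
          omega
        rcases eq_or_ne i 1 with rfl | hi1
        · simp [hm1]
        simp [hi0, hi1, hκ2]
    · rw [if_neg]
      · push Not at hk
        obtain ⟨i, hi, hne⟩ := hk
        have : (k.prod fun i n => pairedVars R N i ^ n) = 0 :=
          Finset.prod_eq_zero (Finsupp.mem_support_iff.mpr hne) (by
            change pairedVars R N i ^ k i = 0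
            rw [pairedVars_eq_zero (by omega), zero_pow hne])
        rw [this, map_zero]
      · intro h
        obtain ⟨j, -, rfl⟩ := Finset.mem_image.mp h
        exact hk fun i hi => by rw [hκ2 j i (by omega) (by omega), hm i hi]
  rw [MvPowerSeries.coeff_subst (hasSubst_pairedVars N)]
  simp only [hterm]
  rw [finsum_eq_sum_of_support_subset (s := (Finset.range (m 0 + 1)).image κ) _ ?_,
    Finset.sum_image hinj.injOn]
  · refine Finset.sum_congr rfl fun j hj => ?_
    rw [if_pos (Finset.mem_image_of_mem κ hj), hκ1, smul_eq_mul, mul_comm]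
  · intro k hk
    by_contra h
    exact hk (by simp only [if_neg (show ¬ k ∈ (Finset.range (m 0 + 1)).image κ from h), smul_zero])

/-- A symmetric series with the cancellation property is determined by its coefficients at the
monomials all of whose exponents are odd. -/
theorem IsSymmSeries.eq_zero_of_odd [IsDomain R] [CharZero R] {f : MvPowerSeries ℕ R}
    (h : IsSymmSeries f)
    (hc : ∀ N, MvPowerSeries.subst (pairedVars R N) f = MvPowerSeries.subst (tailVars R N) f)
    (hodd : ∀ m : ℕ →₀ ℕ, (∀ i ∈ m.support, Odd (m i)) → MvPowerSeries.coeff m f = 0) :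
    f = 0 := by
  -- the coefficient of a monomial with an even exponent is expressed by coefficients of monomials
  -- of the same degree in more variables
  have key (n : ℕ) : ∀ m : ℕ →₀ ℕ, m.degree < m.support.card + n →
      MvPowerSeries.coeff m f = 0 := by
    induction n with
    | zero =>
      intro m hm
      have : m.support.card ≤ m.degree := by
        rw [Finset.card_eq_sum_ones, Finsupp.degree]
        exact Finset.sum_le_sum fun i hi =>
          Nat.one_le_iff_ne_zero.mpr (Finsupp.mem_support_iff.mp hi)
      omega
    | succ n ih =>
      have normal (m : ℕ →₀ ℕ) (hm : m.degree < m.support.card + (n + 1)) (h0 : m 0 ≠ 0)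
          (he : Even (m 0)) (h1 : m 1 = 0) : MvPowerSeries.coeff m f = 0 := by
        obtain ⟨N, hN⟩ := exists_forall_le_eq_zero m
        have hrel := congrArg (MvPowerSeries.coeff m) (hc N)
        rw [coeff_subst_tailVars f h0, coeff_subst_pairedVars f h1 fun i hi => hN i (by omega),
          Finset.sum_range_succ] at hrel
        obtain ⟨K, hK⟩ : ∃ K, m 0 = K + 1 := ⟨m 0 - 1, by omega⟩
        have hsplit : m = Finsupp.single 0 (m 0) + m.erase 0 := (Finsupp.single_add_erase 0 m).symm
        have hmid (j : ℕ) (hj0 : j ≠ 0) (hj : j < m 0) : MvPowerSeries.coeff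
            (Finsupp.single 0 (m 0 - j) + Finsupp.single 1 j + m.erase 0) f = 0 := by
          apply ih
          have hdeg : (Finsupp.single 0 (m 0 - j) + Finsupp.single 1 j + m.erase 0).degree =
              m.degree := by
            conv_rhs => rw [hsplit]
            simp only [map_add, Finsupp.degree_single]
            omega
          have hsupp : (Finsupp.single 0 (m 0 - j) + Finsupp.single 1 j + m.erase 0).support =
              insert 1 m.support := by
            ext i
            rw [Finsupp.mem_support_iff, Finset.mem_insert, Finsupp.mem_support_iff]
            rcases eq_or_ne i 0 with rfl | hi0
            · simp [h0]; omega
            rcases eq_or_ne i 1 with rfl | hi1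
            · simp [hj0]
            simp [hi0, hi1]
          rw [hdeg, hsupp, Finset.card_insert_of_notMem (by simpa using h1)]
          omega
        rw [hK, Finset.sum_range_succ', ← hK, Finset.sum_eq_zero fun j hj => by
          rw [hmid (j + 1) (by omega) (by have := Finset.mem_range.mp hj; omega), mul_zero]] at hrel
        -- the two extreme terms of the alternating sum are equal by symmetry, so they add up to
        -- twice the coefficient in question
        have hlast : MvPowerSeries.coeff
            (Finsupp.single 0 (m 0 - m 0) + Finsupp.single 1 (m 0) + m.erase 0) f =
            MvPowerSeries.coeff m f := by
          rw [← h.coeff_mapDomain 0 1 m]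
          congr 2
          ext i
          rw [Finsupp.mapDomain_equiv_apply, Equiv.symm_swap]
          rcases eq_or_ne i 0 with rfl | hi0
          · simp [h1]
          rcases eq_or_ne i 1 with rfl | hi1
          · simp [h1]
          rw [Equiv.swap_apply_of_ne_of_ne hi0 hi1]
          simp [hi0, hi1]
        rw [hlast, he.neg_one_pow] at hrel
        simp only [zero_add, pow_zero, one_mul, Nat.sub_zero, Finsupp.single_zero, add_zero,
          Finsupp.single_add_erase] at hrel
        rw [← two_mul] at hrel
        exact (mul_eq_zero.mp hrel).resolve_left two_ne_zero
      -- move a variable with an even exponent to position `0` and an absent one to position `1`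
      intro m hm
      by_cases hm' : ∀ i ∈ m.support, Odd (m i)
      · exact hodd m hm'
      push Not at hm'
      obtain ⟨i, hi, hie⟩ := hm'
      rw [Nat.not_odd_iff_even] at hie
      obtain ⟨q, hq⟩ := exists_forall_le_eq_zero (m.mapDomain (Equiv.swap 0 i))
      set q' := q + 2
      rw [← h.coeff_mapDomain 0 i m, ← h.coeff_mapDomain 1 q' (m.mapDomain (Equiv.swap 0 i))]
      have hval : ((m.mapDomain (Equiv.swap 0 i)).mapDomain (Equiv.swap 1 q')) 0 = m i := by
        rw [Finsupp.mapDomain_equiv_apply, Equiv.symm_swap,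
          Equiv.swap_apply_of_ne_of_ne (by omega) (by omega), Finsupp.mapDomain_equiv_apply,
          Equiv.symm_swap, Equiv.swap_apply_left]
      refine normal _ ?_ ?_ ?_ ?_
      · rw [Finsupp.degree_mapDomain, Finsupp.degree_mapDomain,
          Finsupp.mapDomain_support_of_injective (Equiv.injective _),
          Finsupp.mapDomain_support_of_injective (Equiv.injective _),
          Finset.card_image_of_injective _ (Equiv.injective _),
          Finset.card_image_of_injective _ (Equiv.injective _)]
        exact hm
      · rw [hval]; exact Finsupp.mem_support_iff.mp hi
      · rw [hval]; exact hie
      · rw [Finsupp.mapDomain_equiv_apply, Equiv.symm_swap, Equiv.swap_apply_left]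
        exact hq q' (by omega)
  ext m
  rw [map_zero]
  exact key (m.degree + 1) m (by omega)

end Vanishing

/-! ### Series in the odd power sums -/

section Triangularity

variable {R : Type*} [CommRing R]

theorem coeff_mul_powerSum (g : MvPowerSeries ℕ R) {r : ℕ} (hr : r ≠ 0) (m : ℕ →₀ ℕ) :
    MvPowerSeries.coeff m (g * powerSum R r) =
      ∑ i ∈ m.support with r ≤ m i, MvPowerSeries.coeff (m - Finsupp.single i r) g := by
  classical
  let _ : TopologicalSpace R := ⊥
  have _ : DiscreteTopology R := ⟨rfl⟩
  have h := (hasSum_powerSum (R := R) hr).mul_left g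
  rw [MvPowerSeries.WithPiTopology.hasSum_iff_hasSum_coeff] at h
  have hterm (i : ℕ) : MvPowerSeries.coeff m (g * MvPowerSeries.X i ^ r) =
      if i ∈ m.support.filter (r ≤ m ·) then MvPowerSeries.coeff (m - Finsupp.single i r) g
        else 0 := by
    rw [MvPowerSeries.X_pow_eq, MvPowerSeries.coeff_mul_monomial, mul_one]
    congr 1
    rw [Finsupp.single_le_iff, Finset.mem_filter, Finsupp.mem_support_iff, eq_iff_iff]
    exact ⟨fun h => ⟨by omega, h⟩, fun h => h.2⟩
  have h1 := h m
  simp only [hterm] at h1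
  refine h1.unique ?_
  rw [← Finset.sum_congr rfl fun i hi => if_pos hi]
  exact hasSum_sum_of_ne_finset_zero fun i hi => if_neg hi

/-- The multiplicities of the exponents of a monomial with odd exponents: the value at `k` is the
number of variables with exponent `2 k + 1`. For general monomials, a positive exponent `2 k` is
counted at `k` as well. -/
noncomputable def oddType (m : ℕ →₀ ℕ) : ℕ →₀ ℕ := m.sum fun _ v => Finsupp.single (v / 2) 1

theorem degree_oddType (m : ℕ →₀ ℕ) : (oddType m).degree = m.support.card := by
  simp [oddType, Finsupp.sum, map_sum]

theorem oddType_apply (m : ℕ →₀ ℕ) (k : ℕ) :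
    oddType m k = (m.support.filter (m · / 2 = k)).card := by
  rw [oddType, Finsupp.sum, Finsupp.finsetSum_apply, Finset.card_filter]
  exact Finset.sum_congr rfl fun i _ => by rw [Finsupp.single_apply]

theorem oddType_single_add {m : ℕ →₀ ℕ} {i r : ℕ} (hr : r ≠ 0) (hi : m i = 0) :
    oddType (m + Finsupp.single i r) = oddType m + Finsupp.single (r / 2) 1 := by
  unfold oddType
  rw [Finsupp.sum_add_index_of_disjoint]
  · simp [Finsupp.sum, Finsupp.support_single i hr]
  · rw [Finsupp.support_single i hr, Finset.disjoint_singleton_right]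
    simpa using hi

theorem degree_eq_of_odd {m : ℕ →₀ ℕ} (hm : ∀ i ∈ m.support, Odd (m i)) :
    m.degree = 2 * Finsupp.weight id (oddType m) + m.support.card := by
  rw [oddType, Finsupp.sum, map_sum, Finset.mul_sum, Finset.card_eq_sum_ones,
    ← Finset.sum_add_distrib, Finsupp.degree]
  refine Finset.sum_congr rfl fun i hi => ?_
  rw [Finsupp.weight_single]
  have := Nat.odd_iff.mp (hm i hi)
  simp only [id, smul_eq_mul, one_mul]
  omega

theorem IsSymmSeries.coeff_eq_of_oddType_eq {f : MvPowerSeries ℕ R} (h : IsSymmSeries f)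
    {m m' : ℕ →₀ ℕ} (hm : ∀ i ∈ m.support, Odd (m i)) (hm' : ∀ i ∈ m'.support, Odd (m' i))
    (heq : oddType m = oddType m') : MvPowerSeries.coeff m f = MvPowerSeries.coeff m' f := by
  refine h.coeff_eq_of_card_fiber_eq fun v _ => ?_
  rcases Nat.even_or_odd v with hv | hv
  · have hz (k : ℕ →₀ ℕ) (hk : ∀ i ∈ k.support, Odd (k i)) : k.support.filter (k · = v) = ∅ :=
      Finset.filter_eq_empty_iff.mpr fun i hi h => Nat.not_even_iff_odd.mpr (hk i hi) (h ▸ hv)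
    rw [hz m hm, hz m' hm']
  · have hz (k : ℕ →₀ ℕ) (hk : ∀ i ∈ k.support, Odd (k i)) :
        (k.support.filter (k · = v)).card = oddType k (v / 2) := by
      rw [oddType_apply]
      congr 1
      refine Finset.filter_congr fun i hi => ?_
      have := Nat.odd_iff.mp (hk i hi)
      have := Nat.odd_iff.mp hv
      omega
    rw [hz m hm, hz m' hm', heq]

/-- The product of odd power sums with given multiplicities. -/
noncomputable def oddPowerProd (R : Type*) [CommRing R] (e : ℕ →₀ ℕ) : MvPowerSeries ℕ R :=
  e.prod fun k n => powerSum R (2 * k + 1) ^ n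

theorem oddPowerProd_add_single (e : ℕ →₀ ℕ) (k : ℕ) :
    oddPowerProd R (e + Finsupp.single k 1) = oddPowerProd R e * powerSum R (2 * k + 1) := by
  unfold oddPowerProd
  rw [Finsupp.prod_add_index' (by simp) (by simp [pow_add]), Finsupp.prod_single_index (by simp),
    pow_one]

/-- Triangularity of the products of odd power sums with respect to the number of factors: the
monomials in `∏ p_{r_j}` have at most as many variables as there are factors, and those with as many
variables are the ones with exponents `r_j`. -/
theorem coeff_oddPowerProd (R : Type*) [CommRing R] (e : ℕ →₀ ℕ) (m : ℕ →₀ ℕ) :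
    ∃ n : ℕ, MvPowerSeries.coeff m (oddPowerProd R e) = n ∧
      (n ≠ 0 → m.degree = 2 * Finsupp.weight id e + e.degree ∧ m.support.card ≤ e.degree ∧
        (m.support.card = e.degree → oddType m = e)) ∧
      ((∀ i ∈ m.support, Odd (m i)) → oddType m = e → n ≠ 0) := by
  classical
  generalize hd : e.degree = d
  induction d generalizing e m with
  | zero =>
    obtain rfl : e = 0 := (Finsupp.degree_eq_zero_iff e).mp hd
    by_cases hm : m = 0
    · subst hm
      exact ⟨1, by simp [oddPowerProd], by simp [oddType], by simp⟩
    · refine ⟨0, by simp [oddPowerProd, MvPowerSeries.coeff_one, hm], by simp, fun _ h => ?_⟩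
      have := degree_oddType m
      rw [h] at this
      exact absurd (by simpa using this.symm) hm
  | succ d ih =>
    obtain ⟨k, hk⟩ : ∃ k, e k ≠ 0 := by
      by_contra! h
      have : e = 0 := Finsupp.ext h
      simp [this] at hd
    obtain ⟨e, rfl⟩ : ∃ e', e = e' + Finsupp.single k 1 :=
      ⟨e - Finsupp.single k 1, (tsub_add_cancel_of_le (by
        rw [Finsupp.single_le_iff]; omega)).symm⟩
    simp only [map_add, Finsupp.degree_single, Nat.add_right_cancel_iff] at hd
    choose ν h1 h2 h3 using fun m => ih e m hd
    refine ⟨∑ i ∈ m.support with 2 * k + 1 ≤ m i, ν (m - Finsupp.single i (2 * k + 1)), ?_,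
      fun hne => ?_, fun hodd htype => ?_⟩
    · rw [oddPowerProd_add_single, coeff_mul_powerSum _ (by omega), Nat.cast_sum]
      exact Finset.sum_congr rfl fun i _ => h1 _
    · obtain ⟨i, hi, hνi⟩ := Finset.exists_ne_zero_of_sum_ne_zero hne
      obtain ⟨-, hle⟩ := Finset.mem_filter.mp hi
      obtain ⟨m, rfl⟩ : ∃ m', m = m' + Finsupp.single i (2 * k + 1) :=
        ⟨m - Finsupp.single i (2 * k + 1), (tsub_add_cancel_of_le (by
          rwa [Finsupp.single_le_iff])).symm⟩
      rw [add_tsub_cancel_right] at hνi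
      obtain ⟨h4, h5, h6⟩ := h2 m hνi
      have hsupp : (m + Finsupp.single i (2 * k + 1)).support = insert i m.support := by
        ext j
        rw [Finset.mem_insert, Finsupp.mem_support_iff, Finsupp.mem_support_iff]
        rcases eq_or_ne j i with rfl | hj
        · simp
        · simp [hj]
      rw [hsupp]
      refine ⟨?_, (Finset.card_insert_le _ _).trans (by omega), fun hcard => ?_⟩
      · simp only [map_add, Finsupp.degree_single, Finsupp.weight_single, id, smul_eq_mul, h4]
        omega
      · by_cases hmi : i ∈ m.support
        · rw [Finset.insert_eq_of_mem hmi] at hcard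
          omega
        · rw [Finset.card_insert_of_notMem hmi] at hcard
          rw [oddType_single_add (by omega) (Finsupp.notMem_support_iff.mp hmi), h6 (by omega)]
          congr 2
          omega
    · have hpos : oddType m k ≠ 0 := by rw [htype]; simp
      rw [oddType_apply, Finset.card_ne_zero] at hpos
      obtain ⟨i, hi⟩ := hpos
      obtain ⟨hi, hik⟩ := Finset.mem_filter.mp hi
      have hmi : m i = 2 * k + 1 := by
        have := Nat.odd_iff.mp (hodd i hi)
        omega
      have hadd : m.erase i + Finsupp.single i (2 * k + 1) = m := by
        rw [← hmi, Finsupp.erase_add_single]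
      have hsub : m - Finsupp.single i (2 * k + 1) = m.erase i := by
        conv_lhs => rw [← hadd]
        rw [add_tsub_cancel_right]
      refine (Finset.sum_pos' (fun _ _ => Nat.zero_le _)
        ⟨i, Finset.mem_filter.mpr ⟨hi, hmi.ge⟩, ?_⟩).ne'
      rw [hsub]
      refine Nat.pos_of_ne_zero (h3 _ (fun j hj => ?_) ?_)
      · rw [Finsupp.support_erase, Finset.mem_erase] at hj
        rw [Finsupp.erase_ne hj.1]
        exact hodd j hj.2
      · rw [← hadd, oddType_single_add (by omega) (by simp)] at htype
        have : (2 * k + 1) / 2 = k := by omega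
        rw [this] at htype
        exact add_right_cancel htype

/-- A system of linear equations for the coefficients of a power series that is triangular with
respect to a rank function, with units on the diagonal, can be solved. -/
theorem exists_solution_of_triangular {σ : Type*} (ρ : (σ →₀ ℕ) → ℕ)
    (T : (σ →₀ ℕ) → MvPowerSeries σ R →+ R) (u v : (σ →₀ ℕ) → R) (huv : ∀ e, u e * v e = 1)
    (hT : ∀ e G, (∀ e', ρ e' < ρ e → MvPowerSeries.coeff e' G = 0) →
      T e G = u e * MvPowerSeries.coeff e G) (y : (σ →₀ ℕ) → R) :
    ∃ G : MvPowerSeries σ R, ∀ e, T e G = y e := by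
  classical
  let trunc (e : σ →₀ ℕ) (g : ∀ e', ρ e' < ρ e → R) : MvPowerSeries σ R :=
    fun e' => if h : ρ e' < ρ e then g e' h else 0
  let G : MvPowerSeries σ R := (measure ρ).wf.fix fun e g => v e * (y e - T e (trunc e g))
  let H (e : σ →₀ ℕ) : MvPowerSeries σ R := trunc e fun e' _ => MvPowerSeries.coeff e' G
  have hG (e : σ →₀ ℕ) : MvPowerSeries.coeff e G = v e * (y e - T e (H e)) :=
    (measure ρ).wf.fix_eq _ e
  have hH (e e' : σ →₀ ℕ) : MvPowerSeries.coeff e' (H e) =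
      if ρ e' < ρ e then MvPowerSeries.coeff e' G else 0 := rfl
  refine ⟨G, fun e => ?_⟩
  have h := hT e (G - H e) fun e' he' => by rw [map_sub, hH, if_pos he', sub_self]
  rw [map_sub, map_sub, hH, if_neg (lt_irrefl _), sub_zero, hG e] at h
  linear_combination h + (y e - T e (H e)) * huv e

theorem isSymmSeries_subst_oddPowerSum (G : MvPowerSeries ℕ R) :
    IsSymmSeries (MvPowerSeries.subst (fun k => powerSum R (2 * k + 1)) G) := fun i j => by
  rw [MvPowerSeries.subst_comp_subst_apply (hasSubst_oddPowerSum R) (hasSubst_X_comp _)]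
  congr 1
  ext1 k
  exact isSymmSeries_powerSum (by omega) i j

/-- Some series in the odd power sums has the same coefficients as a given symmetric series at all
monomials with odd exponents. -/
theorem exists_subst_oddPowerSum_coeff_eq [Algebra ℚ R] {f : MvPowerSeries ℕ R}
    (hf : IsSymmSeries f) :
    ∃ G : MvPowerSeries ℕ R, ∀ m : ℕ →₀ ℕ, (∀ i ∈ m.support, Odd (m i)) →
      MvPowerSeries.coeff m (MvPowerSeries.subst (fun k => powerSum R (2 * k + 1)) G) =
        MvPowerSeries.coeff m f := by
  -- one equation for every type `e`; types without a representing monomial get a trivial equation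
  have hrow (e : ℕ →₀ ℕ) : ∃ (T : MvPowerSeries ℕ R →+ R) (u v y : R), u * v = 1 ∧
      (∀ G, (∀ e', Finsupp.weight id e' < Finsupp.weight id e →
        MvPowerSeries.coeff e' G = 0) → T G = u * MvPowerSeries.coeff e G) ∧
      ∀ G, T G = y → ∀ m : ℕ →₀ ℕ, (∀ i ∈ m.support, Odd (m i)) → oddType m = e →
        MvPowerSeries.coeff m (MvPowerSeries.subst (fun k => powerSum R (2 * k + 1)) G) =
          MvPowerSeries.coeff m f := by
    by_cases h : ∃ m : ℕ →₀ ℕ, (∀ i ∈ m.support, Odd (m i)) ∧ oddType m = e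
    · obtain ⟨m, hm, rfl⟩ := h
      obtain ⟨n, hn, -, hn0⟩ := coeff_oddPowerProd R (oddType m) m
      refine ⟨AddMonoidHom.mk' (fun G => MvPowerSeries.coeff m
        (MvPowerSeries.subst (fun k => powerSum R (2 * k + 1)) G))
          fun G H => ?_, n, algebraMap ℚ R (n : ℚ)⁻¹, MvPowerSeries.coeff m f, ?_, fun G hG => ?_,
          fun G hG m' hm' htype => ?_⟩
      · rw [← map_add, ← MvPowerSeries.subst_add (hasSubst_oddPowerSum R)]
      · rw [← map_natCast (algebraMap ℚ R), ← map_mul,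
          mul_inv_cancel₀ (Nat.cast_ne_zero.mpr (hn0 hm rfl)), map_one]
      · rw [AddMonoidHom.mk'_apply, MvPowerSeries.coeff_subst (hasSubst_oddPowerSum R),
          finsum_eq_single _ (oddType m)]
        · rw [mul_comm, ← hn]
          rfl
        · intro e' he'
          obtain ⟨n', hn', h1, -⟩ := coeff_oddPowerProd R e' m
          change MvPowerSeries.coeff e' G * MvPowerSeries.coeff m (oddPowerProd R e') = 0
          by_cases hz : n' = 0
          · rw [hn', hz, Nat.cast_zero, mul_zero]
          · obtain ⟨h2, h3, h4⟩ := h1 hz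
            rw [degree_eq_of_odd hm] at h2
            have h5 : m.support.card ≠ e'.degree := fun h => he' (h4 h).symm
            rw [hG e' (by omega), zero_mul]
      · rw [(isSymmSeries_subst_oddPowerSum G).coeff_eq_of_oddType_eq hm' hm htype,
          hf.coeff_eq_of_oddType_eq hm' hm htype]
        exact hG
    · exact ⟨(MvPowerSeries.coeff e).toAddMonoidHom, 1, 1, 0, one_mul 1,
        fun G _ => (one_mul _).symm, fun G _ m hm htype => absurd ⟨m, hm, htype⟩ h⟩
  choose T u v y huv hT hy using hrow
  obtain ⟨G, hG⟩ := exists_solution_of_triangular (fun e => Finsupp.weight id e) T u v huv hT y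
  exact ⟨G, fun m hm => hy _ G (hG _) m hm rfl⟩

end Triangularity

section Criterion

variable {R : Type*} [CommRing R]

theorem subst_pairedVars_subst_oddPowerSum (G : MvPowerSeries ℕ R) (N : ℕ) :
    MvPowerSeries.subst (pairedVars R N)
      (MvPowerSeries.subst (fun k => powerSum R (2 * k + 1)) G) =
    MvPowerSeries.subst (tailVars R N)
      (MvPowerSeries.subst (fun k => powerSum R (2 * k + 1)) G) := by
  rw [MvPowerSeries.subst_comp_subst_apply (hasSubst_oddPowerSum R) (hasSubst_pairedVars N),
    MvPowerSeries.subst_comp_subst_apply (hasSubst_oddPowerSum R) (hasSubst_tailVars N)]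
  congr 1
  ext1 k
  rw [subst_pairedVars_powerSum N (by omega), (odd_two_mul_add_one k).neg_pow, add_neg_cancel,
    add_zero]

/-- A symmetric series which does not change when a pair of variables `t, -t` is adjoined is a
series in the odd power sums. -/
theorem IsSymmSeries.mem_oddPowerSumSeries [Algebra ℚ R] [IsDomain R] [CharZero R]
    {f : MvPowerSeries ℕ R} (hf : IsSymmSeries f)
    (hc : ∀ N, MvPowerSeries.subst (pairedVars R N) f = MvPowerSeries.subst (tailVars R N) f) :
    f ∈ oddPowerSumSeries R := by
  obtain ⟨G, hG⟩ := exists_subst_oddPowerSum_coeff_eq hf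
  refine ⟨G, ?_⟩
  refine (sub_eq_zero.mp ((hf.sub (isSymmSeries_subst_oddPowerSum G)).eq_zero_of_odd (fun N => ?_)
    fun m hm => ?_)).symm
  · rw [MvPowerSeries.subst_sub (hasSubst_pairedVars N),
      MvPowerSeries.subst_sub (hasSubst_tailVars N), hc, subst_pairedVars_subst_oddPowerSum]
  · rw [map_sub, hG m hm, sub_self]

end Criterion

theorem mainTheorem1 (a b c d : MvPolynomial (Fin 4) ℚ)
    (ha : a = MvPolynomial.X 0) (hb : b = MvPolynomial.X 1)
    (hc : c = MvPolynomial.X 2) (hd : d = MvPolynomial.X 3) :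
    logSeries (schurSum a b c d)
      - formalSum (fun n : ℕ+ =>
          ((1 / (2 * (n : ℚ))) • (a ^ (n : ℕ) * (b ^ (n : ℕ) - c ^ (n : ℕ)))) •
            powerSum (MvPolynomial (Fin 4) ℚ) (2 * n))
      - formalSum (fun n : ℕ+ =>
          ((1 / (4 * (n : ℚ))) • (a ^ (n : ℕ) * b ^ (n : ℕ) * c ^ (n : ℕ) * d ^ (n : ℕ))) •
            powerSum (MvPolynomial (Fin 4) ℚ) (2 * n) ^ 2)
      ∈ oddPowerSumSeries (MvPolynomial (Fin 4) ℚ) := by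
  have hs : a * b * c * d ≠ 0 := by
    subst ha hb hc hd
    simp [MvPolynomial.X_ne_zero]
  exact (isSymmSeries_correctedLog a b c d).mem_oddPowerSumSeries fun N =>
    subst_pairedVars_correctedLog hs N
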